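/- Let $(X,\mathscr F,(\mathscr F_t)_{t\ge 0},\mu)$ be a probability space with a right-continuous filtration such that $\mathscr F_0$ is the $\sigma$-algebra generated by the $\mu$-null sets (the null sets being members of $\mathscr F$), and let $E$ be a reflexive real Banach space. For an $E$-valued process $M$ put $M^*_t=\sup_{s\le t}\|M_s\|_E$ and $M^*_\infty=\sup_{t>0}M^*_t$. Let $H^1(\mu,E)$ be the space of càdlàg $E$-valued martingales $M$ with $M^*_\infty\in L^1(\mu)$ for which there is $M_\infty\in L^1(\mu,E)$ with $M_t=\mathbb E[M_\infty\mid\mathscr F_t]$ a.s. for all $t\ge 0$; its norm is $\|M\|=\int_X M^*_\infty\,d\mu$. Let $(M^n)_{n}$ be a bounded sequence in $H^1(\mu,E)$, and suppose that at least one of the following conditions holds. 1. The set $\{M^n_T : n\in\mathbb N,\ T \text{ a stopping time}\}$ is uniformly integrable. 2. The set $\{\Delta M^n_T : n\in\mathbb N,\ T \text{ a stopping time}\}$ is uniformly integrable. Here stopping times take values in $[0,\infty]$, $M^n_T$ and $\Delta M^n_T$ are taken on $\{T<\infty\}$ (and are $0$ on $\{T=\infty\}$), $\Delta M_t=M_t-M_{t-}$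 with $M_{0-}=M_0$, and a set $K$ of $E$-valued random variables is uniformly integrable if $\sup_{\xi\in K}\int_X\|\xi\|_E\,d\mu<\infty$ and for every $\varepsilon>0$ there is $\delta>0$ such that $\sup_{\xi\in K}\int_A\|\xi\|_E\,d\mu\le\varepsilon$ whenever $A\in\mathscr F$ and $\mu(A)\le\delta$. Then there exist convex combinations $N^k\in\mathrm{co}\{M^n:n\ge k\}$ such that $(N^k)_k$ converges in the u.c.p. topology; that is, there is an adapted càdlàg $E$-valued process $N$ such that $D(N^k,N)\to 0$, where $$D(M,N)=\sum_{n=1}^\infty\frac1{2^n}\int_X 1\wedge (M-N)^*_n\,d\mu .$$ -/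

import Mathlib

open MeasureTheory Filter Topology
open scoped NNReal ENNReal

noncomputable section

namespace HardyMartingale

/-- A real normed space is reflexive if the canonical embedding into its bidual is onto. -/
def IsReflexiveSpace (E : Type*) [NormedAddCommGroup E] [NormedSpace ℝ E] : Prop :=
  Function.Surjective (NormedSpace.inclusionInDoubleDual ℝ E)

/-- The standing conditions on a stochastic basis `(X, 𝓕, (𝓕 t), μ)` with time set `[0, ∞)`:
`𝓕 0` is generated by the `μ`-null events, and the filtration is right-continuous. -/
structure IsStochasticBasis {X : Type*} {m : MeasurableSpace X} (F : Filtration ℝ≥0 m)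
    (μ : Measure X) : Prop where
  zero_eq : F 0 = MeasurableSpace.generateFrom {A : Set X | MeasurableSet A ∧ μ A = 0}
  right_cont : ∀ t : ℝ≥0, F t = ⨅ s > t, F s

section Processes

variable {X E : Type*} [NormedAddCommGroup E]

/-- All paths are right-continuous with left limits (the left limit at time `0` is no condition,
since the filter `𝓝[<] 0` on `ℝ≥0` is trivial). -/
def IsCadlag (M : ℝ≥0 → X → E) : Prop :=
  ∀ ω : X, ∀ t : ℝ≥0,
    ContinuousWithinAt (fun s => M s ω) (Set.Ici t) t ∧
      ∃ l : E, Tendsto (fun s => M s ω) (𝓝[<] t) (𝓝 l)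

/-- The maximal process `M*_t(ω) = sup_{s ≤ t} ‖M_s(ω)‖`. -/
def maxUpTo (M : ℝ≥0 → X → E) (t : ℝ≥0) (ω : X) : ℝ≥0∞ :=
  ⨆ (s : ℝ≥0) (_ : s ≤ t), ‖M s ω‖ₑ

/-- The maximal function `M*_∞ = sup_{t > 0} M*_t`. -/
def maxFun (M : ℝ≥0 → X → E) (ω : X) : ℝ≥0∞ :=
  ⨆ (t : ℝ≥0) (_ : 0 < t), maxUpTo M t ω

/-- The value `M_T` of a process at a `[0, ∞]`-valued random time, on `{T < ∞}`; it is `0` on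
`{T = ∞}`. -/
def valueAt (M : ℝ≥0 → X → E) (T : X → WithTop ℝ≥0) (ω : X) : E :=
  match T ω with
  | ⊤ => 0
  | (t : ℝ≥0) => M t ω

/-- The jump process `ΔM_t = M_t - M_{t-}`, with `M_{0-} = M_0` (so that `ΔM_0 = 0`). -/
def jump (M : ℝ≥0 → X → E) (t : ℝ≥0) (ω : X) : E :=
  M t ω - Function.leftLim (fun s => M s ω) t

/-- The `H¹`-norm `∫ M*_∞ dμ`. -/
def hardyNorm [MeasurableSpace X] (μ : Measure X) (M : ℝ≥0 → X → E) : ℝ≥0∞ :=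
  ∫⁻ ω, maxFun M ω ∂μ

/-- The metric of uniform convergence on compacts in probability,
`D(M, N) = ∑_{n ≥ 1} 2⁻ⁿ ∫ 1 ∧ (M - N)*_n dμ`. -/
def ucpDist [MeasurableSpace X] (μ : Measure X) (M N : ℝ≥0 → X → E) : ℝ≥0∞ :=
  ∑' n : ℕ, (2⁻¹ : ℝ≥0∞) ^ (n + 1) *
    ∫⁻ ω, min 1 (maxUpTo (M - N) ((n : ℝ≥0) + 1) ω) ∂μ

/-- Convergence in the u.c.p. topology on the space of adapted càdlàg processes. -/
structure TendstoUcp {m : MeasurableSpace X} (F : Filtration ℝ≥0 m) (μ : Measure X)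
    (N : ℕ → ℝ≥0 → X → E) (L : ℝ≥0 → X → E) : Prop where
  adapted : ∀ k, StronglyAdapted F (N k)
  cadlag : ∀ k, IsCadlag (N k)
  limit_adapted : StronglyAdapted F L
  limit_cadlag : IsCadlag L
  tendsto : Tendsto (fun k => ucpDist μ (N k) L) atTop (𝓝 0)

/-- Membership in the martingale Hardy space `H¹(μ, E)`: a càdlàg martingale with integrable
maximal function which is closed by an integrable terminal value. -/
structure MemHardy [NormedSpace ℝ E] [CompleteSpace E] {m : MeasurableSpace X}
    (F : Filtration ℝ≥0 m) (μ : Measure X) (M : ℝ≥0 → X → E) : Prop where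
  martingale : Martingale M F μ
  cadlag : IsCadlag M
  max_integrable : hardyNorm μ M < ∞
  terminal : ∃ ξ : X → E, Integrable ξ μ ∧ ∀ t : ℝ≥0, M t =ᵐ[μ] μ[ξ | F t]

/-- The set `{M^n_T : n ∈ ℕ, T a stopping time}` is uniformly integrable, i.e. bounded in `L¹` and
uniformly absolutely continuous with respect to `μ`. -/
def UniformlyIntegrableAtStoppingTimes {m : MeasurableSpace X} (F : Filtration ℝ≥0 m)
    (μ : Measure X) (M : ℕ → ℝ≥0 → X → E) : Prop :=
  UniformIntegrable
    (fun p : ℕ × {T : X → WithTop ℝ≥0 // IsStoppingTime F T} => valueAt (M p.1) p.2.1) 1 μ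

end Processes

end HardyMartingale

end

/-! Each martingale is stopped before it can become large, in such a way that the stopped values at
each fixed time are uniformly integrable, and with probability summable in the index no stopping
takes place. Under the first condition no stopping is needed. Under the second, Kadec–Pełczyński
subsequence splitting of the maximal functions gives a subsequence for which `min M* (2 ^ j)` is
uniformly integrable. If `τ j` is the first exit from the ball of radius `2 ^ j`, the stopped
process is bounded by `min M* (2 ^ j)`, plus the initial value (almost surely bounded, since `F 0`
is trivial), plus the jump at `τ j`; by Markov's inequality `τ j` is finite with probability at most
`C * 2⁻¹ ^ j`.

Uniformly integrable sequences with values in a reflexive space have forward convex combinations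
that are Cauchy in `L¹`, and a diagonal argument finds common coefficients for all integer times
(`exists_isForwardCoeff_cauchy`). Truncation reduces this to bounded sequences. There, minimizing
`L²`-norms makes countably many norming functionals converge almost everywhere; reflexivity turns
this into pointwise weak convergence; and the argument behind Simons' inequality
(`exists_convexHull_integral_norm_le`) turns weak convergence into convergence in `L¹` of convex
combinations.

Doob's weak type inequality upgrades `L¹`-convergence of the stopped combinations at time `T` to
uniform convergence in probability on `[0, T]`. The same coefficients applied to the unstopped
martingales give the same paths off a set of small probability, so these are u.c.p. Cauchy as well,
and completeness supplies the limit. -/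

noncomputable section
namespace HardyMartingale

/-! ### Forward convex combinations: diagonal argument and minimizing sequences -/

section ForwardConvex

variable {V : Type*} [AddCommGroup V] [Module ℝ V]

/-- Each `y k` is a convex combination of the elements `x n` with `n ≥ k`. -/
def IsForwardConvex (x y : ℕ → V) : Prop :=
  ∀ k, y k ∈ convexHull ℝ (x '' Set.Ici k)

lemma convexHull_image_Ici_anti (x : ℕ → V) {k l : ℕ} (h : k ≤ l) :
    convexHull ℝ (x '' Set.Ici l) ⊆ convexHull ℝ (x '' Set.Ici k) :=
  convexHull_mono (Set.image_mono (Set.Ici_subset_Ici.2 h))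

lemma convexHull_image_Ici_subset {x : ℕ → V} {s : Set V} (hs : Convex ℝ s) {n : ℕ}
    (hx : ∀ j, n ≤ j → x j ∈ s) : convexHull ℝ (x '' Set.Ici n) ⊆ s := by
  refine convexHull_min ?_ hs
  rintro _ ⟨j, hj, rfl⟩
  exact hx j hj

lemma IsForwardConvex.refl (x : ℕ → V) : IsForwardConvex x x :=
  fun k => subset_convexHull ℝ _ ⟨k, le_refl k, rfl⟩

lemma IsForwardConvex.convexHull_subset {x y : ℕ → V} (h : IsForwardConvex x y) (k : ℕ) :
    convexHull ℝ (y '' Set.Ici k) ⊆ convexHull ℝ (x '' Set.Ici k) :=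
  convexHull_image_Ici_subset (convex_convexHull ℝ _)
    fun j hj => convexHull_image_Ici_anti x hj (h j)

lemma IsForwardConvex.trans {x y z : ℕ → V} (h : IsForwardConvex x y)
    (h' : IsForwardConvex y z) : IsForwardConvex x z :=
  fun k => h.convexHull_subset k (h' k)

lemma IsForwardConvex.subseq (x : ℕ → V) {φ : ℕ → ℕ} (hφ : StrictMono φ) :
    IsForwardConvex x (x ∘ φ) :=
  fun k => subset_convexHull ℝ _ ⟨φ k, hφ.le_apply, rfl⟩

lemma IsForwardConvex.mem {x y : ℕ → V} (h : IsForwardConvex x y) {s : Set V}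
    (hs : Convex ℝ s) {n : ℕ} (hx : ∀ j, n ≤ j → x j ∈ s) {k : ℕ} (hk : n ≤ k) : y k ∈ s :=
  convexHull_image_Ici_subset hs (fun j hj => hx j (hk.trans hj)) (h k)

/-- Diagonal argument: countably many properties, each attainable by passing to forward convex
combinations and stable under eventually forward convex combinations, hold simultaneously. -/
lemma exists_forwardConvex_forall (x : ℕ → V) (P : ℕ → (ℕ → V) → Prop)
    (hex : ∀ i y, IsForwardConvex x y → ∃ z, IsForwardConvex y z ∧ P i z)
    (hst : ∀ i y z n, P i y → (∀ k, n ≤ k → z k ∈ convexHull ℝ (y '' Set.Ici k)) → P i z) :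
    ∃ z, IsForwardConvex x z ∧ ∀ i, P i z := by
  choose! F hF hP using hex
  let Y : ℕ → ℕ → V := fun i => Nat.rec x (fun i y => F i y) i
  have hY : ∀ i, Y (i + 1) = F i (Y i) := fun i => rfl
  have hx : ∀ i, IsForwardConvex x (Y i) := by
    intro i
    induction i with
    | zero => exact IsForwardConvex.refl x
    | succ i ih => rw [hY]; exact ih.trans (hF i _ ih)
  have hle : ∀ i j, IsForwardConvex (Y i) (Y (i + j)) := by
    intro i j
    induction j with
    | zero => exact IsForwardConvex.refl _
    | succ j ih => rw [← add_assoc, hY]; exact ih.trans (hF _ _ (hx _))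
  -- `P i` first holds at stage `i + 1`, and from index `i + 1` on the diagonal consists of forward
  -- combinations of that stage.
  refine ⟨fun k => Y k k, fun k => hx k k, fun i => hst i (Y (i + 1)) _ (i + 1) ?_ ?_⟩
  · rw [hY]; exact hP i _ (hx i)
  · intro k hk
    obtain ⟨j, rfl⟩ := Nat.exists_eq_add_of_le hk
    exact hle (i + 1) j _

/-- Minimizing sequences for a functional with a parallelogram inequality are Cauchy. -/
lemma exists_forwardConvex_cauchy (x : ℕ → V) (q : V → ℝ) (D : V → V → ℝ) (K : ℝ)
    (hq : ∀ v, 0 ≤ q v) (hK : ∀ v ∈ convexHull ℝ (Set.range x), q v ≤ K)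
    (hD : ∀ u ∈ convexHull ℝ (Set.range x), ∀ v ∈ convexHull ℝ (Set.range x),
      D u v ≤ 2 * q u + 2 * q v - 4 * q ((2⁻¹ : ℝ) • u + (2⁻¹ : ℝ) • v)) :
    ∃ z, IsForwardConvex x z ∧ ∀ ε > 0, ∃ n, ∀ k l, n ≤ k → n ≤ l → D (z k) (z l) ≤ ε := by
  set C : ℕ → Set V := fun k => convexHull ℝ (x '' Set.Ici k) with hC
  have hCne : ∀ k, (q '' C k).Nonempty := fun k => ⟨_, x k, IsForwardConvex.refl x k, rfl⟩
  have hCr : ∀ k, C k ⊆ convexHull ℝ (Set.range x) := fun k =>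
    convexHull_mono (Set.image_subset_range _ _)
  have hbb : ∀ k, BddBelow (q '' C k) := fun k =>
    ⟨0, by rintro _ ⟨v, -, rfl⟩; exact hq v⟩
  set r : ℕ → ℝ := fun k => sInf (q '' C k) with hr
  have hrmono : Monotone r := fun k l hkl =>
    csInf_le_csInf (hbb k) (hCne l) (Set.image_mono (convexHull_image_Ici_anti x hkl))
  have hrle : ∀ k, ∀ v ∈ C k, r k ≤ q v := fun k v hv => csInf_le (hbb k) ⟨v, hv, rfl⟩
  have hrK : ∀ k, r k ≤ K := fun k =>
    (hrle k _ (IsForwardConvex.refl x k)).trans (hK _ (hCr k (IsForwardConvex.refl x k)))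
  have hrt : Tendsto r atTop (𝓝 (⨆ k, r k)) :=
    tendsto_atTop_ciSup hrmono ⟨K, by rintro _ ⟨k, rfl⟩; exact hrK k⟩
  have hrsup : ∀ k, r k ≤ ⨆ k, r k := fun k => hrmono.ge_of_tendsto hrt k
  have hz : ∀ k : ℕ, ∃ v ∈ C k, q v < r k + 1 / ((k : ℝ) + 1) := by
    intro k
    obtain ⟨_, ⟨v, hv, rfl⟩, hlt⟩ := exists_lt_of_csInf_lt (hCne k)
      (lt_add_of_pos_right (r k) (Nat.one_div_pos_of_nat (n := k) (α := ℝ)))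
    exact ⟨v, hv, hlt⟩
  choose z hzC hzq using hz
  refine ⟨z, hzC, fun ε hε => ?_⟩
  -- The midpoint has `q ≥ r n`, while `q (z k)` is at most `⨆ k, r k` plus `1 / (k + 1)`. So `D` is
  -- at most four times the gap to the supremum plus four such errors, eight terms of size `ε / 8`.
  have h1 : ∀ᶠ k in atTop, (⨆ k, r k) - ε / 8 < r k :=
    hrt.eventually (lt_mem_nhds (by linarith))
  have h2 : ∀ᶠ k : ℕ in atTop, 1 / ((k : ℝ) + 1) < ε / 8 :=
    tendsto_one_div_add_atTop_nhds_zero_nat.eventually (gt_mem_nhds (by positivity))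
  obtain ⟨n, hn⟩ := (h1.and h2).exists_forall_of_atTop
  refine ⟨n, fun k l hk hl => ?_⟩
  have hkn : z k ∈ C n := convexHull_image_Ici_anti x hk (hzC k)
  have hln : z l ∈ C n := convexHull_image_Ici_anti x hl (hzC l)
  have hm : (2⁻¹ : ℝ) • z k + (2⁻¹ : ℝ) • z l ∈ C n :=
    convex_convexHull ℝ _ hkn hln (by norm_num) (by norm_num) (by norm_num)
  have := hD _ (hCr n hkn) _ (hCr n hln)
  have h3 := hrle n _ hm
  have h4 := hzq k
  have h5 := hzq l
  have h6 := (hn n le_rfl).1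
  have h7 := (hn k hk).2
  have h8 := (hn l hl).2
  have h9 := hrsup k
  have h10 := hrsup l
  linarith

end ForwardConvex

/-! ### Norming functionals, weak limits and Pettis measurability -/

section Weak

variable {E : Type*} [NormedAddCommGroup E] [NormedSpace ℝ E]

/-- A sequence of functionals of norm at most one which computes the norm on `S`. -/
structure IsNormingOn (d : ℕ → StrongDual ℝ E) (S : Set E) : Prop where
  norm_le : ∀ i, ‖d i‖ ≤ 1
  lt_apply : ∀ x ∈ S, ∀ r < ‖x‖, ∃ i, r < d i x

lemma IsNormingOn.apply_le {d : ℕ → StrongDual ℝ E} {S : Set E} (h : IsNormingOn d S)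
    (i : ℕ) (x : E) : d i x ≤ ‖x‖ :=
  (le_abs_self _).trans (by simpa using (d i).le_of_opNorm_le (h.norm_le i) x)

/-- Hahn–Banach functionals at the points of a countable dense set suffice: moving from `x` to a
nearby point costs the distance twice, once in the norm and once in the functional. The point `0` is
added only to make the set nonempty. -/
lemma exists_isNormingOn {S : Set E} (hS : TopologicalSpace.IsSeparable S) :
    ∃ d : ℕ → StrongDual ℝ E, IsNormingOn d S := by
  obtain ⟨c, hc, hSc⟩ := hS
  obtain ⟨a, ha⟩ := (hc.insert 0).exists_eq_range (Set.insert_nonempty _ _)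
  choose g hg1 hg using fun i => exists_dual_vector'' ℝ (a i)
  refine ⟨g, hg1, fun x hx r hr => ?_⟩
  have hx' : x ∈ closure (Set.range a) := closure_mono (ha ▸ Set.subset_insert 0 c) (hSc hx)
  obtain ⟨_, ⟨i, rfl⟩, hi⟩ := Metric.mem_closure_iff.1 hx' ((‖x‖ - r) / 2) (by linarith)
  refine ⟨i, ?_⟩
  rw [dist_eq_norm] at hi
  have h1 : g i (a i - x) ≤ ‖x - a i‖ := by
    rw [norm_sub_rev]
    exact (le_abs_self _).trans (by simpa using (g i).le_of_opNorm_le (hg1 i) (a i - x))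
  have h2 : ‖x‖ ≤ ‖a i‖ + ‖x - a i‖ := by
    simpa using norm_add_le (a i) (x - a i)
  have h3 : g i (a i) = ‖a i‖ := by simpa using hg i
  rw [map_sub, h3] at h1
  linarith

/-- In a reflexive space, a bounded sequence in a closed subspace on which the functionals `d i`
are norming converges weakly once all the scalar sequences `d i (x n)` converge. -/
lemma exists_weak_limit (hE : IsReflexiveSpace E) {S : Submodule ℝ E} (hS : IsClosed (S : Set E))
    {d : ℕ → StrongDual ℝ E} (hd : IsNormingOn d S) {x : ℕ → E} {K : ℝ}
    (hxS : ∀ n, x n ∈ S) (hxK : ∀ n, ‖x n‖ ≤ K)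
    (hx : ∀ i, ∃ l, Tendsto (fun n => d i (x n)) atTop (𝓝 l)) :
    ∃ y ∈ S, ‖y‖ ≤ K ∧ ∀ f : StrongDual ℝ E, Tendsto (fun n => f (x n)) atTop (𝓝 (f y)) := by
  -- Banach–Alaoglu gives a weak-star limit in the bidual, and reflexivity brings it back to `E`.
  have key : ∀ U : Ultrafilter ℕ, ∃ y : E,
      ∀ f : StrongDual ℝ E, Tendsto (fun n => f (x n)) U (𝓝 (f y)) := by
    intro U
    let J : ℕ → WeakDual ℝ (StrongDual ℝ E) := fun n =>
      StrongDual.toWeakDual (NormedSpace.inclusionInDoubleDual ℝ E (x n))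
    have hJ : ∀ n, J n ∈ WeakDual.toStrongDual ⁻¹'
        Metric.closedBall (0 : StrongDual ℝ (StrongDual ℝ E)) K := by
      intro n
      have h := (NormedSpace.double_dual_bound ℝ E (x n)).trans (hxK n)
      exact (dist_zero_right (NormedSpace.inclusionInDoubleDual ℝ E (x n))).trans_le h
    obtain ⟨ψ, -, hψ⟩ := (WeakDual.isCompact_closedBall (𝕜 := ℝ)
      (0 : StrongDual ℝ (StrongDual ℝ E)) K).ultrafilter_le_nhds (U.map J)
      (le_principal_iff.2 (mem_map.2 (Filter.univ_mem' hJ)))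
    obtain ⟨y, hy⟩ := hE (WeakDual.toStrongDual ψ)
    refine ⟨y, fun f => ?_⟩
    have h1 : Tendsto J U (𝓝 ψ) := hψ
    have h2 := ((WeakDual.eval_continuous f).tendsto ψ).comp h1
    have h3 : ψ f = f y := by
      rw [← NormedSpace.dual_def ℝ E y f, hy]; rfl
    rw [← h3]
    exact h2
  -- By Hahn–Banach separation, weak limits stay in closed convex sets. Hence all ultrafilter limits
  -- lie in `S`, where the `d i` separate points, so they coincide.
  have hmem : ∀ (U : Ultrafilter ℕ) (y : E),
      (∀ f : StrongDual ℝ E, Tendsto (fun n => f (x n)) U (𝓝 (f y))) →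
      ∀ C : Set E, Convex ℝ C → IsClosed C → (∀ n, x n ∈ C) → y ∈ C := by
    intro U y hy C hC hCc hxC
    by_contra hyC
    obtain ⟨f, u, hu, huy⟩ := geometric_hahn_banach_closed_point hC hCc hyC
    exact absurd (le_of_tendsto (hy f) (Eventually.of_forall fun n => (hu _ (hxC n)).le))
      (not_le.2 huy)
  obtain ⟨y, hy⟩ := key (Ultrafilter.of atTop)
  have hyS := hmem _ y hy S S.convex hS hxS
  refine ⟨y, hyS, ?_, fun f => ?_⟩
  · simpa using hmem _ y hy (Metric.closedBall 0 K) (convex_closedBall 0 K)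
      Metric.isClosed_closedBall (by simpa using hxK)
  · rw [tendsto_iff_ultrafilter]
    intro U hU
    obtain ⟨y', hy'⟩ := key U
    have hyS' := hmem _ y' hy' S S.convex hS hxS
    have hdy : ∀ i, d i y' = d i y := by
      intro i
      obtain ⟨l, hl⟩ := hx i
      rw [tendsto_nhds_unique (hy' (d i)) (hl.mono_left hU),
        tendsto_nhds_unique (hy (d i)) (hl.mono_left (Ultrafilter.of_le _))]
    have : y' = y := by
      by_contra hne
      obtain ⟨i, hi⟩ := hd.lt_apply (y' - y) (S.sub_mem hyS' hyS) 0
        (norm_pos_iff.2 (sub_ne_zero.2 hne))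
      rw [map_sub, hdy i, sub_self] at hi
      exact lt_irrefl _ hi
    exact this ▸ hy' f

/-- Pettis' measurability theorem for a norming sequence of functionals. -/
lemma stronglyMeasurable_of_isNormingOn {X : Type*} {m : MeasurableSpace X} {S : Submodule ℝ E}
    (hS : TopologicalSpace.IsSeparable (S : Set E))
    {d : ℕ → StrongDual ℝ E} (hd : IsNormingOn d S) {f : X → E} (hfS : ∀ ω, f ω ∈ S)
    (hf : ∀ i, Measurable fun ω => d i (f ω)) : StronglyMeasurable f := by
  borelize E
  refine stronglyMeasurable_iff_measurable_separable.2
    ⟨?_, hS.mono (Set.range_subset_iff.2 hfS)⟩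
  have hball : ∀ c ∈ S, ∀ r, MeasurableSet {ω | ‖f ω - c‖ ≤ r} := by
    intro c hc r
    -- A closed ball with centre in `S` is, within `S`, a countable intersection of half-spaces.
    have : {ω | ‖f ω - c‖ ≤ r} = ⋂ i, {ω | d i (f ω) - d i c ≤ r} := by
      ext ω
      simp only [Set.mem_ofPred_eq, Set.mem_iInter, ← map_sub]
      refine ⟨fun h i => (hd.apply_le i _).trans h, fun h => ?_⟩
      by_contra! hr
      obtain ⟨i, hi⟩ := hd.lt_apply _ (S.sub_mem (hfS ω) hc) r hr
      exact absurd (h i) (not_le.2 hi)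
    rw [this]
    exact MeasurableSet.iInter fun i => measurableSet_le ((hf i).sub_const _) measurable_const
  obtain ⟨t, htS, htc, hSt⟩ := hS.exists_countable_dense_subset
  refine measurable_of_isOpen fun U hU => ?_
  have : f ⁻¹' U = ⋃ c ∈ t, ⋃ n : ℕ, ⋃ (_ : Metric.closedBall c (1 / ((n : ℝ) + 1)) ⊆ U),
      {ω | ‖f ω - c‖ ≤ 1 / ((n : ℝ) + 1)} := by
    ext ω
    simp only [Set.mem_preimage, Set.mem_iUnion, Set.mem_ofPred_eq, exists_prop]
    constructor
    · intro h
      obtain ⟨ε, hε, hεU⟩ := Metric.isOpen_iff.1 hU _ h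
      obtain ⟨n, hn⟩ := exists_nat_one_div_lt (half_pos hε)
      obtain ⟨c, hc, hdc⟩ := Metric.mem_closure_iff.1 (hSt (hfS ω)) _
        (Nat.one_div_pos_of_nat (n := n) (α := ℝ))
      refine ⟨c, hc, n, fun y hy => hεU ?_, by rw [← dist_eq_norm]; exact hdc.le⟩
      rw [Metric.mem_closedBall] at hy
      rw [Metric.mem_ball]
      have := dist_triangle y c (f ω)
      rw [dist_comm c] at this
      linarith
    · rintro ⟨c, -, n, hU', hn⟩
      exact hU' (by rwa [Metric.mem_closedBall, dist_eq_norm])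
  rw [this]
  exact MeasurableSet.biUnion htc fun c hc => MeasurableSet.iUnion fun n =>
    MeasurableSet.iUnion fun _ => hball c (htS hc) _

end Weak

/-! ### From weak convergence to small convex combinations in `L¹` -/

section Simons

variable {X E : Type*} {m : MeasurableSpace X} [NormedAddCommGroup E]

/-- The almost everywhere strongly measurable functions with bounded norm. -/
def boundedMeas [NormedSpace ℝ E] (μ : Measure X) : Submodule ℝ (X → E) where
  carrier := {u | AEStronglyMeasurable u μ ∧ ∃ K, ∀ ω, ‖u ω‖ ≤ K}
  add_mem' := by
    rintro u v ⟨hu, K, hK⟩ ⟨hv, K', hK'⟩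
    exact ⟨hu.add hv, K + K', fun ω => (norm_add_le _ _).trans (add_le_add (hK ω) (hK' ω))⟩
  zero_mem' := ⟨aestronglyMeasurable_const, 0, by simp⟩
  smul_mem' := by
    rintro c u ⟨hu, K, hK⟩
    exact ⟨hu.const_smul c, ‖c‖ * K, fun ω => by
      simpa [norm_smul] using mul_le_mul_of_nonneg_left (hK ω) (abs_nonneg c)⟩

lemma mem_boundedMeas [NormedSpace ℝ E] {μ : Measure X} {u : X → E} :
    u ∈ boundedMeas μ ↔ AEStronglyMeasurable u μ ∧ ∃ K, ∀ ω, ‖u ω‖ ≤ K := Iff.rfl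

lemma integrable_of_mem_boundedMeas [NormedSpace ℝ E] {μ : Measure X} [IsFiniteMeasure μ]
    {u : X → E} (hu : u ∈ boundedMeas μ) : Integrable u μ := by
  obtain ⟨h, K, hK⟩ := hu
  exact Integrable.of_bound h K (Eventually.of_forall hK)

/-- If a bounded sequence of functions converges weakly to `0` almost everywhere, then convex
combinations of it have arbitrarily small `L¹`-norm. The proof follows the one of Simons'
inequality. -/
theorem exists_convexHull_integral_norm_le [NormedSpace ℝ E] [CompleteSpace E] (μ : Measure X)
    [IsProbabilityMeasure μ] {g : ℕ → X → E} (hg : ∀ n, AEStronglyMeasurable (g n) μ) {K : ℝ}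
    (hK : ∀ n ω, ‖g n ω‖ ≤ K)
    (hw : ∀ᵐ ω ∂μ, ∀ f : StrongDual ℝ E, Tendsto (fun n => f (g n ω)) atTop (𝓝 0))
    {ε : ℝ} (hε : 0 < ε) : ∃ u ∈ convexHull ℝ (Set.range g), ∫ ω, ‖u ω‖ ∂μ ≤ ε := by
  by_contra! hcon
  set C : ℕ → Set (X → E) := fun n => convexHull ℝ (g '' Set.Ici n) with hC
  set p : (X → E) → ℝ := fun u => ∫ ω, ‖u ω‖ ∂μ with hp
  have hint : ∀ u ∈ boundedMeas (E := E) μ, Integrable (fun ω => ‖u ω‖) μ :=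
    fun u hu => (integrable_of_mem_boundedMeas hu).norm
  have hgG : ∀ n, g n ∈ boundedMeas (E := E) μ := fun n => mem_boundedMeas.2 ⟨hg n, K, hK n⟩
  have hCG : ∀ n, C n ⊆ (boundedMeas (E := E) μ : Set (X → E)) := by
    intro n
    exact convexHull_image_Ici_subset (Submodule.convex (𝕜 := ℝ) (boundedMeas (E := E) μ)) fun j _ => hgG j
  have hCK : ∀ n, ∀ u ∈ C n, ∀ ω, ‖u ω‖ ≤ K := by
    intro n u hu ω
    have hconv : Convex ℝ {u : X → E | ‖u ω‖ ≤ K} := by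
      have : {u : X → E | ‖u ω‖ ≤ K} = LinearMap.proj (R := ℝ) (φ := fun _ : X => E) ω ⁻¹'
          Metric.closedBall 0 K := by ext; simp
      rw [this]
      exact (convex_closedBall 0 K).linear_preimage _
    exact convexHull_image_Ici_subset hconv (fun j _ => hK j ω) hu
  have hpnn : ∀ u, 0 ≤ p u := fun u => integral_nonneg fun ω => norm_nonneg _
  have hpcomb : ∀ u ∈ boundedMeas (E := E) μ, ∀ v ∈ boundedMeas (E := E) μ, ∀ w : X → E,
      w ∈ boundedMeas (E := E) μ → (∀ ω, w ω = (2⁻¹ : ℝ) • u ω + (2⁻¹ : ℝ) • v ω) →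
      p w ≤ 2⁻¹ * p u + 2⁻¹ * p v := by
    intro u hu v hv w hwm hw
    simp only [hp]
    rw [← integral_const_mul, ← integral_const_mul, ← integral_add ((hint u hu).const_mul _)
      ((hint v hv).const_mul _)]
    refine integral_mono (hint w hwm) (((hint u hu).const_mul _).add ((hint v hv).const_mul _))
      fun ω => ?_
    simp only [hw]
    refine (norm_add_le _ _).trans ?_
    simp [norm_smul]
  have hpdiff : ∀ u ∈ boundedMeas (E := E) μ, ∀ v ∈ boundedMeas (E := E) μ, ∀ r : ℝ,
      (∀ ω, ‖u ω - v ω‖ ≤ r) → p u ≤ p v + r := by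
    intro u hu v hv r hr
    have : p v + r = ∫ ω, (‖v ω‖ + r) ∂μ := by
      rw [integral_add (hint v hv) (integrable_const _)]; simp [hp]
    rw [this]
    refine integral_mono (hint u hu) ((hint v hv).add (integrable_const _)) fun ω => ?_
    have := norm_add_le (v ω) (u ω - v ω)
    simp only [add_sub_cancel] at this
    linarith [hr ω]
  set η : ℝ := ε / 12 with hη
  have hηpos : 0 < η := by positivity
  have hY : ∀ (w : X → E) (n : ℕ), ∃ y ∈ C n, ∀ y' ∈ C n,
      p (w + (2⁻¹ : ℝ) ^ n • y) ≤ p (w + (2⁻¹ : ℝ) ^ n • y') + η * (4⁻¹ : ℝ) ^ n := by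
    intro w n
    set q : (X → E) → ℝ := fun y => p (w + (2⁻¹ : ℝ) ^ n • y)
    have hne : (q '' C n).Nonempty := ⟨_, g n, IsForwardConvex.refl g n, rfl⟩
    have hbb : BddBelow (q '' C n) := ⟨0, by rintro _ ⟨v, -, rfl⟩; exact hpnn _⟩
    obtain ⟨_, ⟨y, hy, rfl⟩, hlt⟩ := exists_lt_of_csInf_lt hne
      (lt_add_of_pos_right (sInf (q '' C n)) (show 0 < η * (4⁻¹ : ℝ) ^ n by positivity))
    exact ⟨y, hy, fun y' hy' => hlt.le.trans
      (add_le_add_left (csInf_le hbb ⟨y', hy', rfl⟩) _)⟩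
  -- Simons' construction: `z (n + 1)` adds `2⁻¹ ^ (n + 1) • y n` to `z n`, where `y n` in the
  -- `n`-th tail hull nearly minimizes the norm of `z n + 2⁻¹ ^ n • y`. If all convex combinations
  -- have norm above `ε`, the limit `l` satisfies `2 ^ n * (p l - p (z n)) ≥ ε / 2`, whereas weak
  -- convergence sends the positive part of the integrand to zero.
  choose Y hYC hYmin using hY
  obtain ⟨z, y, hz0, hzs, hyC, hymin⟩ : ∃ z y : ℕ → X → E, z 0 = 0 ∧
      (∀ n, z (n + 1) = z n + (2⁻¹ : ℝ) ^ (n + 1) • y n) ∧ (∀ n, y n ∈ C n) ∧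
      ∀ n, ∀ y' ∈ C n,
        p (z n + (2⁻¹ : ℝ) ^ n • y n) ≤ p (z n + (2⁻¹ : ℝ) ^ n • y') + η * (4⁻¹ : ℝ) ^ n :=
    ⟨fun n => Nat.rec 0 (fun n w => w + (2⁻¹ : ℝ) ^ (n + 1) • Y w n) n,
      fun n => Y (Nat.rec 0 (fun n w => w + (2⁻¹ : ℝ) ^ (n + 1) • Y w n) n) n,
      rfl, fun n => rfl, fun n => hYC _ _, fun n => hYmin _ _⟩
  have hyG : ∀ n, y n ∈ boundedMeas (E := E) μ := fun n => hCG n (hyC n)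
  have hzG : ∀ n, z n ∈ boundedMeas (E := E) μ := by
    intro n
    induction n with
    | zero => exact hz0 ▸ Submodule.zero_mem _
    | succ n ih => rw [hzs]; exact (boundedMeas (E := E) μ).add_mem ih ((boundedMeas (E := E) μ).smul_mem _ (hyG n))
  have hyK : ∀ n ω, ‖y n ω‖ ≤ K := fun n => hCK n _ (hyC n)
  have hdist : ∀ ω n, dist (z n ω) (z (n + 1) ω) ≤ K / 2 / 2 ^ n := by
    intro ω n
    rw [hzs, dist_eq_norm]
    simp only [Pi.add_apply, Pi.smul_apply, sub_add_cancel_left, norm_neg, norm_smul, norm_pow,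
      norm_inv, Real.norm_ofNat]
    calc (2⁻¹ : ℝ) ^ (n + 1) * ‖y n ω‖ ≤ (2⁻¹ : ℝ) ^ (n + 1) * K := by
          gcongr; exact hyK n ω
      _ = K / 2 / 2 ^ n := by rw [pow_succ, inv_pow]; field_simp
  have hlim : ∀ ω, ∃ l, Tendsto (fun n => z n ω) atTop (𝓝 l) := fun ω =>
    cauchySeq_tendsto_of_complete (cauchySeq_of_le_geometric_two (hdist ω))
  choose l hl using hlim
  have hlz : ∀ n ω, ‖z n ω - l ω‖ ≤ K / 2 ^ n := fun n ω => by
    rw [← dist_eq_norm]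
    exact dist_le_of_le_geometric_two_of_tendsto (hdist ω) (hl ω) n
  have hlG : l ∈ boundedMeas (E := E) μ := by
    refine ⟨aestronglyMeasurable_of_tendsto_ae atTop (fun n => (hzG n).1)
      (Eventually.of_forall hl), K, fun ω => ?_⟩
    simpa [hz0] using hlz 0 ω
  set a : ℕ → ℝ := fun n => p (z n + (2⁻¹ : ℝ) ^ n • y n) with ha
  have haG : ∀ n, z n + (2⁻¹ : ℝ) ^ n • y n ∈ boundedMeas (E := E) μ := fun n =>
    (boundedMeas (E := E) μ).add_mem (hzG n) ((boundedMeas (E := E) μ).smul_mem _ (hyG n))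
  have hastep : ∀ n, a n ≤ a (n + 1) + η * (4⁻¹ : ℝ) ^ n := by
    intro n
    -- The average of `y n` and `y (n + 1)` competes in the `n`-th minimization and yields exactly
    -- the function defining `a (n + 1)`.
    have hm : (2⁻¹ : ℝ) • y n + (2⁻¹ : ℝ) • y (n + 1) ∈ C n :=
      convex_convexHull ℝ _ (hyC n) (convexHull_image_Ici_anti g n.le_succ (hyC (n + 1)))
        (by norm_num) (by norm_num) (by norm_num)
    have h1 := hymin n _ hm
    have h2 : z n + (2⁻¹ : ℝ) ^ n • ((2⁻¹ : ℝ) • y n + (2⁻¹ : ℝ) • y (n + 1)) =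
        z (n + 1) + (2⁻¹ : ℝ) ^ (n + 1) • y (n + 1) := by
      rw [hzs, smul_add, smul_smul, smul_smul, ← pow_succ, add_assoc]
    rw [h2] at h1
    exact h1
  have hatail : ∀ n j, a n ≤ a (n + j) + 2 * η * (4⁻¹ : ℝ) ^ n := by
    intro n j
    have : a n ≤ a (n + j) + (2 * η * (4⁻¹ : ℝ) ^ n - 2 * η * (4⁻¹ : ℝ) ^ (n + j)) := by
      induction j with
      | zero => simp
      | succ j ih =>
        have := hastep (n + j)
        have h4 : 0 < (4⁻¹ : ℝ) ^ (n + j) := by positivity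
        rw [← add_assoc, pow_succ]
        nlinarith
    have h4 : 0 < η * (4⁻¹ : ℝ) ^ (n + j) := by positivity
    linarith
  have hal : ∀ n, a n ≤ p l + 2 * K * (2⁻¹ : ℝ) ^ n := by
    intro n
    refine hpdiff _ (haG n) _ hlG _ fun ω => ?_
    have h1 := hlz n ω
    have h2 := hyK n ω
    have h3 : (z n + (2⁻¹ : ℝ) ^ n • y n) ω - l ω = (z n ω - l ω) + (2⁻¹ : ℝ) ^ n • y n ω := by
      simp only [Pi.add_apply, Pi.smul_apply]; abel
    rw [h3]
    refine (norm_add_le _ _).trans ?_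
    rw [norm_smul, norm_pow, norm_inv, Real.norm_ofNat]
    have h4 : (2⁻¹ : ℝ) ^ n * ‖y n ω‖ ≤ (2⁻¹ : ℝ) ^ n * K := by gcongr
    have h5 : K / 2 ^ n = (2⁻¹ : ℝ) ^ n * K := by rw [inv_pow]; field_simp
    linarith
  have hale : ∀ n, a n ≤ p l + 2 * η * (4⁻¹ : ℝ) ^ n := by
    intro n
    have h1 : Tendsto (fun j => p l + 2 * K * (2⁻¹ : ℝ) ^ (n + j) + 2 * η * (4⁻¹ : ℝ) ^ n) atTop
        (𝓝 (p l + 2 * K * 0 + 2 * η * (4⁻¹ : ℝ) ^ n)) := by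
      refine ((tendsto_const_nhds.add (tendsto_const_nhds.mul ?_)).add tendsto_const_nhds)
      have := (tendsto_pow_atTop_nhds_zero_of_lt_one (r := (2⁻¹ : ℝ)) (by norm_num)
        (by norm_num)).comp (tendsto_add_atTop_nat n)
      simpa [Function.comp_def, add_comm] using this
    have := ge_of_tendsto' h1 fun j => (hatail n j).trans (by linarith [hal (n + j)])
    linarith
  -- `z (n + 1)` is the midpoint of `z n` and the function whose norm is `a n`.
  have hzhalf : ∀ n, p (z (n + 1)) ≤ 2⁻¹ * p (z n) + 2⁻¹ * a n := by
    intro n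
    refine hpcomb _ (hzG n) _ (haG n) _ (hzG (n + 1)) fun ω => ?_
    rw [hzs]
    simp only [Pi.add_apply, Pi.smul_apply, smul_add, smul_smul, pow_succ']
    rw [← add_assoc, ← add_smul]
    norm_num
  have ha0 : ε < a 0 := by
    have h0 : z 0 + (2⁻¹ : ℝ) ^ 0 • y 0 = y 0 := by rw [hz0]; simp
    have : y 0 ∈ convexHull ℝ (Set.range g) :=
      convexHull_mono (Set.image_subset_range _ _) (hyC 0)
    simpa only [ha, h0] using hcon _ this
  have hv : ∀ n, ε / 2 ≤ 2 ^ n * (p l - p (z n)) := by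
    -- The gap to `p l` at most halves at each step, up to an error which after scaling by `2 ^ (n +
    -- 1)` is `2 * η * 2⁻¹ ^ n`. The term `4 * η * 2⁻¹ ^ n` absorbs these errors, and `η = ε / 12`
    -- leaves `ε / 2`.
    have : ∀ n, ε - 6 * η + 4 * η * (2⁻¹ : ℝ) ^ n ≤ 2 ^ n * (p l - p (z n)) := by
      intro n
      induction n with
      | zero =>
        have := hale 0
        have h0 : p (z 0) = 0 := by simp [hp, hz0]
        rw [h0]
        simp only [pow_zero, mul_one, one_mul] at this ⊢
        linarith
      | succ n ih =>
        have h1 := hzhalf n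
        have h2 := hale n
        have h3 : (2 : ℝ) ^ n * (4⁻¹ : ℝ) ^ n = (2⁻¹ : ℝ) ^ n := by
          rw [← mul_pow]; norm_num
        have h4 : (2 : ℝ) ^ (n + 1) * (p l - p (z (n + 1))) ≥
            2 ^ n * (p l - p (z n)) - 2 * η * (2⁻¹ : ℝ) ^ n := by
          have h5 : p l - p (z (n + 1)) ≥
              2⁻¹ * (p l - p (z n)) - 2⁻¹ * (2 * η * (4⁻¹ : ℝ) ^ n) := by linarith
          calc (2 : ℝ) ^ (n + 1) * (p l - p (z (n + 1))) ≥ (2 : ℝ) ^ (n + 1) *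
                (2⁻¹ * (p l - p (z n)) - 2⁻¹ * (2 * η * (4⁻¹ : ℝ) ^ n)) := by gcongr
            _ = 2 ^ n * (p l - p (z n)) - 2 * η * (2 ^ n * (4⁻¹ : ℝ) ^ n) := by
              rw [pow_succ]; ring
            _ = _ := by rw [h3]
        rw [pow_succ (2⁻¹ : ℝ)]
        linarith
    intro n
    have := this n
    have h4 : 0 < η * (2⁻¹ : ℝ) ^ n := by positivity
    linarith
  set Q : ℕ → X → ℝ := fun n ω => max (2 ^ n * (‖l ω‖ - ‖z n ω‖)) 0 with hQ
  have hQint : ∀ n, Integrable (fun ω => 2 ^ n * (‖l ω‖ - ‖z n ω‖)) μ := fun n =>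
    ((hint l hlG).sub (hint _ (hzG n))).const_mul _
  have hQK : ∀ n ω, ‖Q n ω‖ ≤ K := by
    intro n ω
    have hK0 : 0 ≤ K := (norm_nonneg _).trans (hK 0 ω)
    rw [Real.norm_eq_abs, abs_of_nonneg (le_max_right _ _)]
    refine max_le ?_ hK0
    have h1 := hlz n ω
    have h2 := norm_sub_norm_le (l ω) (z n ω)
    rw [norm_sub_rev] at h2
    calc 2 ^ n * (‖l ω‖ - ‖z n ω‖) ≤ 2 ^ n * (K / 2 ^ n) := by gcongr; linarith
      _ = K := by field_simp
  have hQlim : ∀ᵐ ω ∂μ, Tendsto (fun n => Q n ω) atTop (𝓝 0) := by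
    filter_upwards [hw] with ω hω
    -- With `f` norming `l ω`, the quantity `2 ^ n * (‖l ω‖ - ‖z n ω‖)` is at most `2 ^ n * f (l ω -
    -- z n ω)`, a weighted average of the `f (y k ω)` with `k ≥ n`.
    obtain ⟨f, hf1, hf⟩ := exists_dual_vector'' ℝ (l ω)
    have hf' : f (l ω) = ‖l ω‖ := by simpa using hf
    rw [Metric.tendsto_atTop]
    intro δ hδ
    have hev : ∀ᶠ n in atTop, f (g n ω) < δ / 2 := (hω f).eventually (gt_mem_nhds (by positivity))
    obtain ⟨n0, hn0⟩ := hev.exists_forall_of_atTop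
    refine ⟨n0, fun n hn => ?_⟩
    have hfy : ∀ k, n0 ≤ k → f (y k ω) ≤ δ / 2 := by
      intro k hk
      have hconv : Convex ℝ {u : X → E | f (u ω) ≤ δ / 2} := by
        have : {u : X → E | f (u ω) ≤ δ / 2} = (f.toLinearMap ∘ₗ
            LinearMap.proj (R := ℝ) (φ := fun _ : X => E) ω) ⁻¹' Set.Iic (δ / 2) := by
          ext; simp
        rw [this]
        exact (convex_Iic _).linear_preimage _
      exact convexHull_image_Ici_subset hconv (fun j hj => (hn0 j (hk.trans hj)).le) (hyC k)
    have hfz : ∀ j, f (z (n + j) ω) ≤ f (z n ω) + δ / 2 * (2⁻¹ ^ n - 2⁻¹ ^ (n + j)) := by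
      intro j
      induction j with
      | zero => simp
      | succ j ih =>
        rw [← add_assoc, hzs]
        simp only [Pi.add_apply, Pi.smul_apply, map_add, map_smul, smul_eq_mul]
        have h1 := mul_le_mul_of_nonneg_left (hfy (n + j) (by omega))
          (show (0 : ℝ) ≤ 2⁻¹ ^ (n + j + 1) by positivity)
        have h2 : (2⁻¹ : ℝ) ^ (n + j) = 2 * 2⁻¹ ^ (n + j + 1) := by rw [pow_succ]; ring
        nlinarith
    have hfl : f (l ω) ≤ f (z n ω) + δ / 2 * 2⁻¹ ^ n := by
      have h1 : Tendsto (fun j => f (z (n + j) ω)) atTop (𝓝 (f (l ω))) := by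
        have := ((f.continuous.tendsto _).comp (hl ω)).comp (tendsto_add_atTop_nat n)
        simpa [Function.comp_def, add_comm] using this
      refine le_of_tendsto' h1 fun j => (hfz j).trans ?_
      have : (0 : ℝ) < 2⁻¹ ^ (n + j) := by positivity
      nlinarith
    have hfzn : f (z n ω) ≤ ‖z n ω‖ :=
      (le_abs_self _).trans (by simpa using f.le_of_opNorm_le hf1 (z n ω))
    rw [Real.dist_eq, sub_zero, abs_of_nonneg (le_max_right _ _)]
    refine max_lt ?_ hδ
    calc 2 ^ n * (‖l ω‖ - ‖z n ω‖) ≤ 2 ^ n * (δ / 2 * 2⁻¹ ^ n) := by gcongr; linarith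
      _ = δ / 2 := by rw [inv_pow]; field_simp
      _ < δ := by linarith
  have hlim0 : Tendsto (fun n => ∫ ω, Q n ω ∂μ) atTop (𝓝 (∫ _, (0 : ℝ) ∂μ)) :=
    tendsto_integral_of_dominated_convergence (fun _ => K)
      (fun n => ((hQint n).sup (integrable_const 0)).1) (integrable_const _)
      (fun n => Eventually.of_forall (hQK n)) hQlim
  rw [integral_zero] at hlim0
  have hge : ∀ n, ε / 2 ≤ ∫ ω, Q n ω ∂μ := by
    intro n
    refine (hv n).trans ?_
    have : 2 ^ n * (p l - p (z n)) = ∫ ω, 2 ^ n * (‖l ω‖ - ‖z n ω‖) ∂μ := by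
      rw [integral_const_mul, integral_sub (hint l hlG) (hint _ (hzG n))]
    rw [this]
    exact integral_mono (hQint n) ((hQint n).sup (integrable_const 0)) fun ω => le_max_left _ _
  have := ge_of_tendsto' hlim0 hge
  linarith

end Simons

/-! ### Bounded sequences of functions with values in a reflexive space -/

section BoundedCompactness

variable {X E V : Type*} {m : MeasurableSpace X} [NormedAddCommGroup E] [NormedSpace ℝ E]
  [AddCommGroup V] [Module ℝ V]

lemma convex_setOf_stronglyMeasurable_norm_le (L : V →ₗ[ℝ] (X → E)) (K : ℝ) :
    Convex ℝ {v | StronglyMeasurable (L v) ∧ ∀ ω, ‖L v ω‖ ≤ K} := by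
  rintro u ⟨hu, hu'⟩ v ⟨hv, hv'⟩ a b ha hb hab
  refine ⟨?_, fun ω => ?_⟩
  · rw [map_add, map_smul, map_smul]
    exact (hu.const_smul a).add (hv.const_smul b)
  · have := convex_closedBall (0 : E) K (x := L u ω) (by simpa using hu' ω) (y := L v ω)
      (by simpa using hv' ω) ha hb hab
    simpa using this

lemma convex_setOf_abs_sub_le (L : V →ₗ[ℝ] ℝ) (l δ : ℝ) : Convex ℝ {v | |L v - l| ≤ δ} := by
  have : {v | |L v - l| ≤ δ} = L ⁻¹' Metric.closedBall l δ := by ext; simp [Real.dist_eq]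
  rw [this]
  exact (convex_closedBall l δ).linear_preimage _

/-- The variance of `|f|` is nonnegative. -/
lemma sq_integral_abs_le {μ : Measure X} [IsProbabilityMeasure μ] {f : X → ℝ}
    (hf : Integrable f μ) (hf2 : Integrable (fun ω => f ω ^ 2) μ) :
    (∫ ω, |f ω| ∂μ) ^ 2 ≤ ∫ ω, f ω ^ 2 ∂μ := by
  set a := ∫ ω, |f ω| ∂μ with ha
  have h : 0 ≤ ∫ ω, (f ω ^ 2 - 2 * a * |f ω| + a ^ 2) ∂μ := by
    refine integral_nonneg fun ω => ?_
    have := sq_nonneg (|f ω| - a)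
    rw [sub_sq, sq_abs] at this
    simpa [mul_comm, mul_left_comm, mul_assoc] using this
  have hf1 : Integrable (fun ω => 2 * a * |f ω|) μ := hf.abs.const_mul _
  have hfs : Integrable (fun ω => f ω ^ 2 - 2 * a * |f ω|) μ := hf2.sub hf1
  rw [integral_add hfs (integrable_const _), integral_sub hf2 hf1, integral_const_mul, ← ha] at h
  simp only [integral_const, probReal_univ, one_smul] at h
  nlinarith

/-- A bounded sequence of real functions has forward convex combinations which converge almost
everywhere. -/
lemma exists_forwardConvex_ae_tendsto (μ : Measure X) [IsProbabilityMeasure μ]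
    (L : V →ₗ[ℝ] (X → ℝ)) (x : ℕ → V) {K : ℝ}
    (hx : ∀ n, StronglyMeasurable (L (x n)) ∧ ∀ ω, ‖L (x n) ω‖ ≤ K) :
    ∃ z, IsForwardConvex x z ∧
      ∀ᵐ ω ∂μ, ∃ l, Tendsto (fun n => L (z n) ω) atTop (𝓝 l) := by
  have hG : ∀ v ∈ convexHull ℝ (Set.range x),
      StronglyMeasurable (L v) ∧ ∀ ω, ‖L v ω‖ ≤ K := by
    intro v hv
    have := convexHull_min (s := Set.range x)
      (t := {v | StronglyMeasurable (L v) ∧ ∀ ω, ‖L v ω‖ ≤ K})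
      (by rintro _ ⟨n, rfl⟩; exact hx n) (convex_setOf_stronglyMeasurable_norm_le L K)
    exact this hv
  have hI : ∀ v ∈ convexHull ℝ (Set.range x), Integrable (L v) μ := fun v hv =>
    Integrable.of_bound (hG v hv).1.aestronglyMeasurable K (Eventually.of_forall (hG v hv).2)
  have hI2 : ∀ u ∈ convexHull ℝ (Set.range x), ∀ v ∈ convexHull ℝ (Set.range x),
      Integrable (fun ω => L u ω * L v ω) μ := fun u hu v hv =>
    (hI v hv).bdd_mul (hG u hu).1.aestronglyMeasurable (Eventually.of_forall (hG u hu).2)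
  -- The squared `L²`-norm is minimized; the parallelogram identity controls the squared
  -- `L²`-distance, which dominates the squared `L¹`-distance.
  obtain ⟨y, hxy, hy⟩ := exists_forwardConvex_cauchy x (fun v => ∫ ω, L v ω ^ 2 ∂μ)
    (fun u v => (∫ ω, |L u ω - L v ω| ∂μ) ^ 2) (K ^ 2)
    (fun v => integral_nonneg fun ω => sq_nonneg _)
    (fun v hv => by
      have h1 : ∫ ω, L v ω ^ 2 ∂μ ≤ ∫ _, K ^ 2 ∂μ := by
        refine integral_mono_of_nonneg (Eventually.of_forall fun ω => sq_nonneg _)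
          (integrable_const _) (Eventually.of_forall fun ω => ?_)
        exact sq_le_sq' (abs_le.1 ((hG v hv).2 ω)).1 (abs_le.1 ((hG v hv).2 ω)).2
      simpa using h1)
    (fun u hu v hv => by
      have huu := hI2 u hu u hu
      have hvv := hI2 v hv v hv
      have huv := hI2 u hu v hv
      have e1 : ∀ ω, (L u ω - L v ω) ^ 2 =
          L u ω * L u ω - 2 * (L u ω * L v ω) + L v ω * L v ω := fun ω => by ring
      have e2 : ∀ ω, L ((2⁻¹ : ℝ) • u + (2⁻¹ : ℝ) • v) ω ^ 2 =
          4⁻¹ * (L u ω * L u ω) + 2⁻¹ * (L u ω * L v ω) + 4⁻¹ * (L v ω * L v ω) := fun ω => by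
        simp only [map_add, map_smul, Pi.add_apply, Pi.smul_apply, smul_eq_mul]; ring
      have hsq : Integrable (fun ω => (L u ω - L v ω) ^ 2) μ := by
        simp only [e1]
        exact (huu.sub (huv.const_mul 2)).add hvv
      refine (sq_integral_abs_le ((hI u hu).sub (hI v hv)) hsq).trans (le_of_eq ?_)
      simp only [Pi.sub_apply, e1, e2, pow_two (L u _), pow_two (L v _)]
      have h1 : Integrable (fun ω => L u ω * L u ω - 2 * (L u ω * L v ω)) μ :=
        huu.sub (huv.const_mul 2)
      have h2 : Integrable (fun ω => 4⁻¹ * (L u ω * L u ω) + 2⁻¹ * (L u ω * L v ω)) μ :=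
        (huu.const_mul _).add (huv.const_mul _)
      rw [integral_add h1 hvv, integral_sub huu (huv.const_mul 2),
        integral_add h2 (hvv.const_mul _),
        integral_add (huu.const_mul _) (huv.const_mul _)]
      simp only [integral_const_mul]
      ring)
  have hyG : ∀ n, y n ∈ convexHull ℝ (Set.range x) := fun n =>
    convexHull_mono (Set.image_subset_range _ _) (hxy n)
  obtain ⟨φ, hφ, hφP⟩ := extraction_forall_of_eventually'
    (P := fun N k => ∀ a b, k ≤ a → k ≤ b → ∫ ω, |L (y a) ω - L (y b) ω| ∂μ ≤ 2⁻¹ ^ N) (by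
      intro N
      obtain ⟨n, hn⟩ := hy ((2⁻¹ ^ N) ^ 2) (by positivity)
      exact ⟨n, fun k hk a b ha hb => le_of_sq_le_sq (hn a b (hk.trans ha) (hk.trans hb))
        (by positivity)⟩)
  refine ⟨y ∘ φ, hxy.trans (IsForwardConvex.subseq y hφ), ?_⟩
  refine Lp.ae_tendsto_of_cauchy_eLpNorm (p := 1) (f := fun n => L (y (φ n)))
    (fun n => (hG _ (hyG _)).1.aestronglyMeasurable) le_rfl
    -- The factor `2` makes room for a strict inequality.
    (B := fun N => 2 * (2⁻¹ : ℝ≥0∞) ^ N) ?_ ?_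
  · rw [ENNReal.tsum_mul_left, ENNReal.tsum_geometric]
    simp [ENNReal.mul_eq_top]
  · intro N a b ha hb
    have h := hφP N (φ a) (φ b) (hφ.monotone ha) (hφ.monotone hb)
    rw [eLpNorm_one_eq_lintegral_enorm]
    have hi : Integrable (fun ω => L (y (φ a)) ω - L (y (φ b)) ω) μ :=
      (hI _ (hyG _)).sub (hI _ (hyG _))
    have h2 : ∫⁻ ω, ‖(L (y (φ a)) - L (y (φ b))) ω‖ₑ ∂μ =
        ENNReal.ofReal (∫ ω, |L (y (φ a)) ω - L (y (φ b)) ω| ∂μ) := by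
      exact (ofReal_integral_norm_eq_lintegral_enorm hi).symm
    rw [h2]
    calc ENNReal.ofReal (∫ ω, |L (y (φ a)) ω - L (y (φ b)) ω| ∂μ)
        ≤ ENNReal.ofReal (2⁻¹ ^ N) := ENNReal.ofReal_le_ofReal h
      _ = (2⁻¹ : ℝ≥0∞) ^ N := by
        rw [ENNReal.ofReal_pow (by norm_num), ENNReal.ofReal_inv_of_pos (by norm_num)]; simp
      _ < 2 * (2⁻¹ : ℝ≥0∞) ^ N := by
        rw [two_mul]
        exact ENNReal.lt_add_right (by simp) (by simp)

/-- A bounded sequence of functions with values in a reflexive space has forward convex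
combinations which are Cauchy in `L¹`. -/
theorem exists_forwardConvex_integral_norm_sub_le [CompleteSpace E] (hE : IsReflexiveSpace E)
    (μ : Measure X) [IsProbabilityMeasure μ] (L : V →ₗ[ℝ] (X → E)) (x : ℕ → V) {K : ℝ}
    (hx : ∀ n, StronglyMeasurable (L (x n)) ∧ ∀ ω, ‖L (x n) ω‖ ≤ K) :
    ∃ z, IsForwardConvex x z ∧ ∀ ε > 0, ∃ n, ∀ k l, n ≤ k → n ≤ l →
      ∫ ω, ‖L (z k) ω - L (z l) ω‖ ∂μ ≤ ε := by
  let S : Submodule ℝ E := (Submodule.span ℝ (⋃ n, Set.range (L (x n)))).topologicalClosure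
  have hSc : IsClosed (S : Set E) := Submodule.isClosed_topologicalClosure _
  have hSs : TopologicalSpace.IsSeparable (S : Set E) := by
    have h1 : TopologicalSpace.IsSeparable (⋃ n, Set.range (L (x n))) :=
      TopologicalSpace.IsSeparable.iUnion fun n => (hx n).1.isSeparable_range
    exact (h1.span (R := ℝ)).closure
  obtain ⟨d, hd⟩ := exists_isNormingOn hSs
  have hxS : ∀ n ω, L (x n) ω ∈ S := fun n ω =>
    Submodule.le_topologicalClosure _ (Submodule.subset_span (Set.mem_iUnion.2 ⟨n, ω, rfl⟩))
  let T : ℕ → V →ₗ[ℝ] (X → ℝ) := fun i => ((d i).toLinearMap.compLeft X) ∘ₗ L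
  have hT : ∀ i v ω, T i v ω = d i (L v ω) := fun i v ω => rfl
  have hGconv := convex_setOf_stronglyMeasurable_norm_le (m := m) L K
  obtain ⟨y, hxy, hy⟩ := exists_forwardConvex_forall x
    (fun i y => ∀ᵐ ω ∂μ, ∃ l, Tendsto (fun n => T i (y n) ω) atTop (𝓝 l))
    (by
      intro i y hxy
      refine exists_forwardConvex_ae_tendsto μ (T i) y (K := K) fun n => ?_
      obtain ⟨h1, h2⟩ := hxy.mem hGconv (n := 0) (fun j _ => hx j) (Nat.zero_le n)
      exact ⟨(d i).continuous.comp_stronglyMeasurable h1, fun ω =>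
        (((d i).le_of_opNorm_le (hd.norm_le i) _).trans (one_mul _).le).trans (h2 ω)⟩)
    (by
      intro i y z n hy hz
      filter_upwards [hy] with ω ⟨l, hl⟩
      refine ⟨l, ?_⟩
      rw [Metric.tendsto_atTop] at hl ⊢
      intro ε hε
      obtain ⟨N, hN⟩ := hl (ε / 2) (half_pos hε)
      refine ⟨max n N, fun k hk => ?_⟩
      have := convexHull_image_Ici_subset
        (convex_setOf_abs_sub_le (LinearMap.proj ω ∘ₗ T i) l (ε / 2)) (n := k) (x := y)
        (fun j hj => by
          have := (hN j ((le_max_right n N).trans (hk.trans hj))).le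
          rwa [Real.dist_eq] at this) (hz k ((le_max_left n N).trans hk))
      rw [Real.dist_eq]
      exact lt_of_le_of_lt this (half_lt_self hε))
  have hyG : ∀ n, StronglyMeasurable (L (y n)) ∧ ∀ ω, ‖L (y n) ω‖ ≤ K := fun n =>
    hxy.mem hGconv (n := 0) (fun j _ => hx j) (Nat.zero_le n)
  have hyS : ∀ n ω, L (y n) ω ∈ S := fun n ω =>
    hxy.mem (s := {v | L v ω ∈ S}) (S.convex.linear_preimage (LinearMap.proj (R := ℝ) (φ := fun _ : X => E) ω ∘ₗ L)) (n := 0)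
      (fun j _ => hxS j ω) (Nat.zero_le n)
  let G : Set X := {ω | ∀ i, ∃ l, Tendsto (fun n => d i (L (y n) ω)) atTop (𝓝 l)}
  have hG : ∀ᵐ ω ∂μ, ω ∈ G := ae_all_iff.2 hy
  have hGm : MeasurableSet G := by
    have : G = ⋂ i, {ω | ∃ l, Tendsto (fun n => d i (L (y n) ω)) atTop (𝓝 l)} := by
      ext; simp [G]
    rw [this]
    exact MeasurableSet.iInter fun i => measurableSet_exists_tendsto fun n =>
      ((d i).continuous.comp_stronglyMeasurable (hyG n).1).measurable
  have hlim : ∀ ω, ∃ v ∈ S, ω ∈ G → ‖v‖ ≤ K ∧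
      ∀ f : StrongDual ℝ E, Tendsto (fun n => f (L (y n) ω)) atTop (𝓝 (f v)) := by
    intro ω
    by_cases h : ω ∈ G
    · obtain ⟨v, hvS, hv⟩ := exists_weak_limit hE hSc hd (fun n => hyS n ω)
        (fun n => (hyG n).2 ω) h
      exact ⟨v, hvS, fun _ => hv⟩
    · exact ⟨0, S.zero_mem, fun h' => absurd h' h⟩
  choose F hFS hF using hlim
  -- The pointwise weak limit takes values in the separable space `S`, so Pettis' theorem makes it
  -- strongly measurable.
  let f : X → E := G.indicator F
  have hfG : ∀ ω ∈ G, f ω = F ω := fun ω h => Set.indicator_of_mem h F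
  have hfK : ∀ ω, ‖f ω‖ ≤ K := by
    intro ω
    by_cases h : ω ∈ G
    · rw [hfG ω h]; exact (hF ω h).1
    · simpa [f, h] using (norm_nonneg _).trans ((hx 0).2 ω)
  have hfm : StronglyMeasurable f := by
    refine stronglyMeasurable_of_isNormingOn hSs hd (fun ω => ?_) fun i => ?_
    · by_cases h : ω ∈ G
      · rw [hfG ω h]; exact hFS ω
      · simp [f, h]
    · refine measurable_of_tendsto_metrizable
        (f := fun n ω => G.indicator (fun ω => d i (L (y n) ω)) ω) (fun n =>
        ((d i).continuous.comp_stronglyMeasurable (hyG n).1).measurable.indicator hGm) ?_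
      rw [tendsto_pi_nhds]
      intro ω
      by_cases h : ω ∈ G
      · simpa [h, hfG ω h] using (hF ω h).2 (d i)
      · simp [f, h]
  have hz : ∀ k : ℕ, ∃ v ∈ convexHull ℝ (y '' Set.Ici k),
      ∫ ω, ‖L v ω - f ω‖ ∂μ ≤ 1 / ((k : ℝ) + 1) := by
    intro k
    -- Each tail, with the weak limit subtracted, is bounded and weakly null almost everywhere, so
    -- the Simons argument applies to it.
    obtain ⟨u, hu, hu'⟩ := exists_convexHull_integral_norm_le μ
      (g := fun n ω => L (y (n + k)) ω - f ω) (K := K + K)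
      (fun n => ((hyG _).1.sub hfm).aestronglyMeasurable)
      (fun n ω => (norm_sub_le _ _).trans (add_le_add ((hyG _).2 ω) (hfK ω)))
      (by
        filter_upwards [hG] with ω hω φ
        have h1 := ((hF ω hω).2 φ).comp (tendsto_add_atTop_nat k)
        have h2 := h1.sub_const (φ (F ω))
        rw [sub_self] at h2
        simpa [Function.comp_def, hfG ω hω] using h2)
      (Nat.one_div_pos_of_nat (n := k) (α := ℝ))
    have hsub : convexHull ℝ (Set.range fun n ω => L (y (n + k)) ω - f ω) ⊆
        {u | ∃ v ∈ convexHull ℝ (y '' Set.Ici k), u = L v - f} := by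
      refine convexHull_min ?_ ?_
      · rintro _ ⟨n, rfl⟩
        exact ⟨y (n + k), subset_convexHull ℝ _ ⟨n + k, Set.mem_Ici.2 (by omega), rfl⟩, rfl⟩
      · rintro _ ⟨v, hv, rfl⟩ _ ⟨w, hw, rfl⟩ a b ha hb hab
        refine ⟨a • v + b • w, convex_convexHull ℝ _ hv hw ha hb hab, ?_⟩
        rw [map_add, map_smul, map_smul, smul_sub, smul_sub]
        have : f = a • f + b • f := by rw [← add_smul, hab, one_smul]
        nth_rw 3 [this]
        abel
    obtain ⟨v, hv, rfl⟩ := hsub hu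
    exact ⟨v, hv, hu'⟩
  choose z hzC hzf using hz
  have hyz : IsForwardConvex y z := hzC
  have hzG : ∀ n, StronglyMeasurable (L (z n)) ∧ ∀ ω, ‖L (z n) ω‖ ≤ K := fun n =>
    (hxy.trans hyz).mem hGconv (n := 0) (fun j _ => hx j) (Nat.zero_le n)
  have hint : ∀ n, Integrable (fun ω => ‖L (z n) ω - f ω‖) μ := fun n =>
    (Integrable.of_bound ((hzG n).1.sub hfm).aestronglyMeasurable (K + K) (Eventually.of_forall
      fun ω => (norm_sub_le _ _).trans (add_le_add ((hzG _).2 ω) (hfK ω)))).norm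
  refine ⟨z, hxy.trans hyz, fun ε hε => ?_⟩
  obtain ⟨n, hn⟩ := exists_nat_one_div_lt (half_pos hε)
  have hn' : ∀ k, n ≤ k → ∫ ω, ‖L (z k) ω - f ω‖ ∂μ ≤ ε / 2 := fun k hk =>
    ((hzf k).trans (Nat.one_div_le_one_div hk)).trans hn.le
  refine ⟨n, fun k l hk hl => ?_⟩
  calc ∫ ω, ‖L (z k) ω - L (z l) ω‖ ∂μ
      ≤ ∫ ω, (‖L (z k) ω - f ω‖ + ‖L (z l) ω - f ω‖) ∂μ := by
        refine integral_mono_of_nonneg (Eventually.of_forall fun ω => norm_nonneg _)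
          ((hint k).add (hint l)) (Eventually.of_forall fun ω => ?_)
        have := norm_sub_le (L (z k) ω - f ω) (L (z l) ω - f ω)
        simpa using this
    _ ≤ ε := by
        rw [integral_add (hint k) (hint l)]
        linarith [hn' k hk, hn' l hl]

end BoundedCompactness

/-! ### Uniformly integrable sequences and common coefficients -/

section UniformlyIntegrableCompactness

variable {X E V : Type*} {m : MeasurableSpace X} [NormedAddCommGroup E] [NormedSpace ℝ E]
  [AddCommGroup V] [Module ℝ V]

/-- Used to carry `L¹`-Cauchy estimates over to forward convex combinations, one argument at a time,
and with `w = 0` to bound truncation remainders. -/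
lemma convex_setOf_lintegral_enorm_sub_le (μ : Measure X) (L : V →ₗ[ℝ] (X → E))
    (hL : ∀ v, StronglyMeasurable (L v)) {w : X → E} (hw : StronglyMeasurable w) (ε : ℝ≥0∞) :
    Convex ℝ {v | ∫⁻ ω, ‖L v ω - w ω‖ₑ ∂μ ≤ ε} := by
  intro u hu v hv a b ha hb hab
  have hb' : ∀ ω, ‖L (a • u + b • v) ω - w ω‖ₑ ≤
      ENNReal.ofReal a * ‖L u ω - w ω‖ₑ + ENNReal.ofReal b * ‖L v ω - w ω‖ₑ := by
    intro ω
    have h1 : L (a • u + b • v) ω - w ω = a • (L u ω - w ω) + b • (L v ω - w ω) := by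
      simp only [map_add, map_smul, Pi.add_apply, Pi.smul_apply, smul_sub]
      have : w ω = a • w ω + b • w ω := by rw [← add_smul, hab, one_smul]
      nth_rw 1 [this]
      abel
    rw [h1]
    refine (enorm_add_le _ _).trans (le_of_eq ?_)
    rw [enorm_smul, enorm_smul, Real.enorm_of_nonneg ha, Real.enorm_of_nonneg hb]
  calc ∫⁻ ω, ‖L (a • u + b • v) ω - w ω‖ₑ ∂μ
      ≤ ∫⁻ ω, (ENNReal.ofReal a * ‖L u ω - w ω‖ₑ + ENNReal.ofReal b * ‖L v ω - w ω‖ₑ) ∂μ :=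
        lintegral_mono hb'
    _ = ENNReal.ofReal a * ∫⁻ ω, ‖L u ω - w ω‖ₑ ∂μ +
        ENNReal.ofReal b * ∫⁻ ω, ‖L v ω - w ω‖ₑ ∂μ := by
        have h1 : Measurable fun ω => ‖L u ω - w ω‖ₑ := ((hL u).sub hw).enorm
        have h2 : Measurable fun ω => ‖L v ω - w ω‖ₑ := ((hL v).sub hw).enorm
        rw [lintegral_add_left (h1.const_mul _), lintegral_const_mul _ h1,
          lintegral_const_mul _ h2]
    _ ≤ ENNReal.ofReal a * ε + ENNReal.ofReal b * ε := by gcongr <;> assumption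
    _ = ε := by
        rw [← add_mul, ← ENNReal.ofReal_add ha hb, hab, ENNReal.ofReal_one, one_mul]

lemma stronglyMeasurable_linearCombination {ι : Type*} {Z : ι → X → E}
    (hZ : ∀ n, StronglyMeasurable (Z n)) (v : ι →₀ ℝ) :
    StronglyMeasurable (Finsupp.linearCombination ℝ Z v) := by
  rw [Finsupp.linearCombination_apply, Finsupp.sum]
  exact Finset.stronglyMeasurable_sum _ fun n _ => (hZ n).const_smul _

/-- A sequence of finitely supported coefficient families is forward convex if its `k`-th member
is a convex combination of the unit coefficients with index at least `k`. -/
def IsForwardCoeff (c : ℕ → ℕ →₀ ℝ) : Prop :=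
  IsForwardConvex (fun n => Finsupp.single n (1 : ℝ)) c

/-- For countably many uniformly integrable sequences with values in a reflexive space there are
common forward convex combinations which are Cauchy in `L¹`. -/
theorem exists_isForwardCoeff_cauchy [CompleteSpace E] (hE : IsReflexiveSpace E)
    (μ : Measure X) [IsProbabilityMeasure μ] {Z : ℕ → ℕ → X → E}
    (hZ : ∀ i n, StronglyMeasurable (Z i n))
    (hui : ∀ i, ∀ ε > 0, ∃ K : ℝ≥0, ∀ n, ∫⁻ ω, (‖Z i n ω‖ₑ - K) ∂μ ≤ ε) :
    ∃ c, IsForwardCoeff c ∧ ∀ i, ∀ ε > 0, ∃ n, ∀ k l, n ≤ k → n ≤ l →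
      ∫⁻ ω, ‖Finsupp.linearCombination ℝ (Z i) (c k) ω -
        Finsupp.linearCombination ℝ (Z i) (c l) ω‖ₑ ∂μ ≤ ε := by
  let T : ℕ → ℕ → ℕ → X → E := fun κ i n => {ω | ‖Z i n ω‖ ≤ κ}.indicator (Z i n)
  have hT : ∀ κ i n, StronglyMeasurable (T κ i n) := fun κ i n =>
    (hZ i n).indicator ((hZ i n).norm.measurableSet_le stronglyMeasurable_const)
  have hTK : ∀ κ i n ω, ‖T κ i n ω‖ ≤ κ := by
    intro κ i n ω
    by_cases h : ω ∈ {ω | ‖Z i n ω‖ ≤ κ}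
    · simp only [T, Set.indicator_of_mem h]
      exact h
    · simp [T, h]
  -- The index `j` encodes a truncation level and a sequence. Working on coefficients lets one
  -- diagonal sequence serve all of them.
  let L : ℕ → (ℕ →₀ ℝ) →ₗ[ℝ] (X → E) := fun j =>
    Finsupp.linearCombination ℝ (T j.unpair.1 j.unpair.2)
  have hL : ∀ j v, StronglyMeasurable (L j v) := fun j v =>
    stronglyMeasurable_linearCombination (hT _ _) v
  obtain ⟨c, hc, hcP⟩ := exists_forwardConvex_forall
    (fun n => Finsupp.single n (1 : ℝ))
    (fun j c => ∀ ε > 0, ∃ n, ∀ k l, n ≤ k → n ≤ l →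
      ∫⁻ ω, ‖L j (c k) ω - L j (c l) ω‖ₑ ∂μ ≤ ε)
    (by
      intro j y hy
      have hyb : ∀ n, StronglyMeasurable (L j (y n)) ∧
          ∀ ω, ‖L j (y n) ω‖ ≤ ((j.unpair.1 : ℕ) : ℝ) := fun n =>
        hy.mem (convex_setOf_stronglyMeasurable_norm_le (L j) _) (n := 0) (fun k _ => by
          refine ⟨hL j _, fun ω => ?_⟩
          simp only [L, Finsupp.linearCombination_single, one_smul]
          exact hTK _ _ _ _) (Nat.zero_le n)
      obtain ⟨z, hyz, hz⟩ := exists_forwardConvex_integral_norm_sub_le hE μ (L j) y hyb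
      refine ⟨z, hyz, fun ε hε => ?_⟩
      have hzb : ∀ n, StronglyMeasurable (L j (z n)) ∧
          ∀ ω, ‖L j (z n) ω‖ ≤ ((j.unpair.1 : ℕ) : ℝ) := fun n =>
        hyz.mem (convex_setOf_stronglyMeasurable_norm_le (L j) _) (n := 0) (fun k _ => hyb k)
          (Nat.zero_le n)
      obtain ⟨r, hr0, hr⟩ := ENNReal.lt_iff_exists_nnreal_btwn.1 hε
      obtain ⟨n, hn⟩ := hz r (by exact_mod_cast hr0)
      refine ⟨n, fun k l hk hl => le_trans ?_ hr.le⟩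
      have hi : ∀ n, Integrable (L j (z n)) μ := fun n =>
        Integrable.of_bound (hzb n).1.aestronglyMeasurable _ (Eventually.of_forall (hzb n).2)
      have h1 := ofReal_integral_norm_eq_lintegral_enorm ((hi k).sub (hi l))
      simp only [Pi.sub_apply] at h1
      rw [← h1]
      exact (ENNReal.ofReal_le_ofReal (hn k l hk hl)).trans (by simp))
    (by
      intro j y z n hy hz ε hε
      obtain ⟨N, hN⟩ := hy ε hε
      refine ⟨max n N, fun k l hk hl => ?_⟩
      have h1 : ∀ a, N ≤ a → ∫⁻ ω, ‖L j (z k) ω - L j (y a) ω‖ₑ ∂μ ≤ ε := fun a ha =>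
        convexHull_image_Ici_subset
          (convex_setOf_lintegral_enorm_sub_le μ (L j) (hL j) (hL j (y a)) ε)
          (fun b hb => hN b a (((le_max_right n N).trans hk).trans hb) ha)
          (hz k ((le_max_left n N).trans hk))
      have h2 := convexHull_image_Ici_subset
          (convex_setOf_lintegral_enorm_sub_le μ (L j) (hL j) (hL j (z k)) ε)
          (fun b hb => by
            have := h1 b (((le_max_right n N).trans hl).trans hb)
            simpa only [Set.mem_ofPred_eq, enorm_sub_rev (L j (y b) _)] using this)
          (hz l ((le_max_left n N).trans hl))
      simpa only [Set.mem_ofPred_eq, enorm_sub_rev (L j (z l) _)] using h2)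
  refine ⟨c, hc, fun i ε hε => ?_⟩
  have hε4 : (0 : ℝ≥0∞) < ε / 6 := ENNReal.div_pos hε.ne' (by simp)
  obtain ⟨K, hK⟩ := hui i (ε / 6) hε4
  obtain ⟨κ, hκ⟩ := exists_nat_ge (2 * K)
  set M := Finsupp.linearCombination ℝ (T κ i) with hM
  set R := Finsupp.linearCombination ℝ (fun n => Z i n - T κ i n) with hR
  have hsum : ∀ v, Finsupp.linearCombination ℝ (Z i) v = M v + R v := by
    intro v
    simp only [hM, hR, Finsupp.linearCombination_apply, Finsupp.sum, ← Finset.sum_add_distrib,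
      smul_sub, add_sub_cancel]
  have hRm : ∀ v, StronglyMeasurable (R v) := fun v =>
    stronglyMeasurable_linearCombination (fun n => (hZ i n).sub (hT κ i n)) v
  -- Where the remainder does not vanish, the norm exceeds `κ ≥ 2 * K`, so it is at most twice its
  -- excess over `K`. Hence `ε / 6` above becomes `ε / 3` below.
  have hRn : ∀ n ω, ‖R (Finsupp.single n 1) ω‖ₑ ≤ 2 * (‖Z i n ω‖ₑ - K) := by
    intro n ω
    simp only [hR, Finsupp.linearCombination_single, one_smul, Pi.sub_apply]
    by_cases h : ω ∈ {ω | ‖Z i n ω‖ ≤ κ}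
    · simp [T, h]
    · have h' : 2 * K ≤ ‖Z i n ω‖₊ := by
        have h1 : (κ : ℝ) < ‖Z i n ω‖ := not_le.1 h
        have h2 : (κ : ℝ≥0) ≤ ‖Z i n ω‖₊ := by exact_mod_cast h1.le
        exact hκ.trans h2
      have h2 : ‖Z i n ω‖₊ ≤ 2 * (‖Z i n ω‖₊ - K) := by
        rw [mul_tsub]
        refine le_tsub_of_add_le_right ?_
        rw [two_mul ‖Z i n ω‖₊]
        exact add_le_add_right h' _
      simp only [T, h, not_false_eq_true, Set.indicator_of_notMem, sub_zero]
      rw [enorm_eq_nnnorm]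
      exact_mod_cast h2
  have hRc : ∀ k, ∫⁻ ω, ‖R (c k) ω‖ₑ ∂μ ≤ ε / 3 := by
    intro k
    have := hc.mem (convex_setOf_lintegral_enorm_sub_le μ R hRm
      (stronglyMeasurable_zero (α := X) (β := E)) (ε / 3))
      (n := 0) (fun n _ => by
        simp only [Set.mem_ofPred_eq, Pi.zero_apply, sub_zero]
        refine (lintegral_mono (hRn n)).trans ?_
        rw [lintegral_const_mul' _ _ (by simp)]
        refine (mul_le_mul_right (hK n) 2).trans (le_of_eq ?_)
        rw [ENNReal.div_eq_inv_mul, ENNReal.div_eq_inv_mul, ← mul_assoc]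
        congr 1
        rw [show (6 : ℝ≥0∞) = 2 * 3 by norm_num, ENNReal.mul_inv (by simp) (by simp),
          ← mul_assoc, ENNReal.mul_inv_cancel (by simp) (by simp), one_mul]) (Nat.zero_le k)
    simpa only [Set.mem_ofPred_eq, Pi.zero_apply, sub_zero] using this
  obtain ⟨n, hn⟩ := hcP (Nat.pair κ i) (ε / 3) (ENNReal.div_pos hε.ne' (by simp))
  simp only [L, Nat.unpair_pair] at hn
  refine ⟨n, fun k l hk hl => ?_⟩
  calc ∫⁻ ω, ‖Finsupp.linearCombination ℝ (Z i) (c k) ω -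
        Finsupp.linearCombination ℝ (Z i) (c l) ω‖ₑ ∂μ
      ≤ ∫⁻ ω, (‖M (c k) ω - M (c l) ω‖ₑ + (‖R (c k) ω‖ₑ + ‖R (c l) ω‖ₑ)) ∂μ := by
        refine lintegral_mono fun ω => ?_
        rw [hsum, hsum]
        have : (M (c k) + R (c k)) ω - (M (c l) + R (c l)) ω =
            (M (c k) ω - M (c l) ω) + (R (c k) ω - R (c l) ω) := by
          simp only [Pi.add_apply]; abel
        rw [this]
        exact (enorm_add_le _ _).trans (add_le_add le_rfl (enorm_sub_le))
    _ = ∫⁻ ω, ‖M (c k) ω - M (c l) ω‖ₑ ∂μ +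
        (∫⁻ ω, ‖R (c k) ω‖ₑ ∂μ + ∫⁻ ω, ‖R (c l) ω‖ₑ ∂μ) := by
        have h1 : ∀ v, Measurable fun ω => ‖R v ω‖ₑ := fun v => (hRm v).enorm
        have h2 : Measurable fun ω => ‖R (c k) ω‖ₑ + ‖R (c l) ω‖ₑ := (h1 _).add (h1 _)
        rw [lintegral_add_right _ h2, lintegral_add_left (h1 _)]
    _ ≤ ε / 3 + (ε / 3 + ε / 3) := add_le_add (hn k l hk hl) (add_le_add (hRc k) (hRc l))
    _ = ε := by rw [← add_assoc, ENNReal.add_thirds]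

end UniformlyIntegrableCompactness

/-! ### Dyadic approximation of times from the right -/

section Grid

/-- The dyadic times `(k + 1) / 2 ^ n`, capped at `t`. -/
def gridTime (n k : ℕ) (t : ℝ≥0) : ℝ≥0 := min (((k : ℝ≥0) + 1) / 2 ^ n) t

lemma gridTime_le (n k : ℕ) (t : ℝ≥0) : gridTime n k t ≤ t := min_le_right _ _

lemma gridTime_mono (n : ℕ) (t : ℝ≥0) : Monotone fun k => gridTime n k t := by
  intro k l hkl
  have : (k : ℝ≥0) ≤ l := by exact_mod_cast hkl
  simp only [gridTime]
  gcongr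

lemma gridTime_succ (n k : ℕ) (t : ℝ≥0) : gridTime (n + 1) (2 * k + 1) t = gridTime n k t := by
  simp only [gridTime]
  congr 1
  push_cast
  rw [pow_succ, show (2 * (k : ℝ≥0) + 1 + 1) = (k + 1) * 2 by ring,
    mul_div_mul_right _ _ two_ne_zero]

lemma exists_gridTime_add_eq (n k j : ℕ) (t : ℝ≥0) :
    ∃ l, l + 1 = 2 ^ j * (k + 1) ∧ gridTime (n + j) l t = gridTime n k t := by
  induction j with
  | zero => exact ⟨k, by simp, rfl⟩
  | succ j ih =>
    obtain ⟨l, hl, h⟩ := ih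
    exact ⟨2 * l + 1, by rw [pow_succ]; linarith, by rw [← add_assoc, gridTime_succ, h]⟩

/-- The `+ 1` in `gridTime` puts the chosen grid point on the right of `a`, as needed for
right-continuity of paths and for discretized stopping times. -/
lemma le_gridTime_floor (n : ℕ) {a t : ℝ≥0} (h : a ≤ t) : a ≤ gridTime n ⌊2 ^ n * a⌋₊ t := by
  refine le_min ?_ h
  rw [le_div_iff₀ (by positivity), mul_comm]
  exact (Nat.lt_floor_add_one _).le

lemma gridTime_floor_le (n : ℕ) (a t : ℝ≥0) : gridTime n ⌊2 ^ n * a⌋₊ t ≤ a + (2⁻¹) ^ n := by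
  refine (min_le_left _ _).trans ?_
  rw [div_le_iff₀ (by positivity), add_mul, ← mul_pow, inv_mul_cancel₀ two_ne_zero, one_pow,
    mul_comm a]
  gcongr
  exact Nat.floor_le (zero_le)

lemma tendsto_gridTime_floor {a t : ℝ≥0} (h : a ≤ t) :
    Tendsto (fun n => gridTime n ⌊2 ^ n * a⌋₊ t) atTop (𝓝[≥] a) := by
  refine tendsto_nhdsWithin_iff.2 ⟨?_, Eventually.of_forall fun n => le_gridTime_floor n h⟩
  refine tendsto_of_tendsto_of_tendsto_of_le_of_le tendsto_const_nhds ?_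
    (fun n => le_gridTime_floor n h) (fun n => gridTime_floor_le n a t)
  have := (tendsto_pow_atTop_nhds_zero_of_lt_one (r := (2⁻¹ : ℝ≥0)) zero_le
    (by rw [← NNReal.coe_lt_coe]; norm_num)).const_add a
  simpa using this

end Grid

/-! ### Maximal functions and Doob's inequality -/

section MaximalFunction

variable {X E : Type*} [NormedAddCommGroup E] {M : ℝ≥0 → X → E}

lemma IsCadlag.tendsto_gridTime (hM : IsCadlag M) (ω : X) {a t : ℝ≥0} (h : a ≤ t) :
    Tendsto (fun n => M (gridTime n ⌊2 ^ n * a⌋₊ t) ω) atTop (𝓝 (M a ω)) :=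
  (hM ω a).1.tendsto.comp (tendsto_gridTime_floor h)

lemma enorm_le_maxUpTo (M : ℝ≥0 → X → E) {s t : ℝ≥0} (h : s ≤ t) (ω : X) :
    ‖M s ω‖ₑ ≤ maxUpTo M t ω :=
  le_iSup₂_of_le s h le_rfl

lemma maxUpTo_mono (M : ℝ≥0 → X → E) {s t : ℝ≥0} (h : s ≤ t) (ω : X) :
    maxUpTo M s ω ≤ maxUpTo M t ω :=
  iSup₂_le fun _ hr => enorm_le_maxUpTo M (hr.trans h) ω

lemma maxUpTo_le_maxFun (M : ℝ≥0 → X → E) (t : ℝ≥0) (ω : X) : maxUpTo M t ω ≤ maxFun M ω :=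
  (maxUpTo_mono M (le_add_of_nonneg_right zero_le) ω).trans
    (le_iSup₂_of_le (t + 1) (by positivity) le_rfl)

lemma enorm_le_maxFun (M : ℝ≥0 → X → E) (t : ℝ≥0) (ω : X) : ‖M t ω‖ₑ ≤ maxFun M ω :=
  (enorm_le_maxUpTo M le_rfl ω).trans (maxUpTo_le_maxFun M t ω)

/-- Right-continuity reduces the supremum to countably many dyadic times, whence measurability. -/
lemma IsCadlag.maxUpTo_eq (hM : IsCadlag M) (t : ℝ≥0) (ω : X) :
    maxUpTo M t ω = ⨆ n, ⨆ k, ‖M (gridTime n k t) ω‖ₑ := by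
  refine le_antisymm (iSup₂_le fun s hs => ?_)
    (iSup_le fun n => iSup_le fun k => enorm_le_maxUpTo M (gridTime_le n k t) ω)
  exact le_of_tendsto' ((hM.tendsto_gridTime ω hs).enorm) fun n =>
    le_iSup_of_le n (le_iSup_of_le ⌊2 ^ n * s⌋₊ le_rfl)

lemma maxFun_eq (M : ℝ≥0 → X → E) (ω : X) : maxFun M ω = ⨆ n : ℕ, maxUpTo M n ω := by
  refine le_antisymm (iSup₂_le fun t _ => ?_) (iSup_le fun n => maxUpTo_le_maxFun M n ω)
  obtain ⟨n, hn⟩ := exists_nat_ge t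
  exact le_iSup_of_le n (maxUpTo_mono M hn ω)

lemma IsCadlag.measurable_maxUpTo {m : MeasurableSpace X} (hM : IsCadlag M)
    (hm : ∀ t, StronglyMeasurable (M t)) (t : ℝ≥0) : Measurable (maxUpTo M t) := by
  have : maxUpTo M t = fun ω => ⨆ n, ⨆ k, ‖M (gridTime n k t) ω‖ₑ :=
    funext fun ω => hM.maxUpTo_eq t ω
  rw [this]
  exact Measurable.iSup fun n => Measurable.iSup fun k => (hm _).enorm

lemma IsCadlag.measurable_maxFun {m : MeasurableSpace X} (hM : IsCadlag M)
    (hm : ∀ t, StronglyMeasurable (M t)) : Measurable (maxFun M) := by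
  have : maxFun M = fun ω => ⨆ n : ℕ, maxUpTo M n ω := funext fun ω => maxFun_eq M ω
  rw [this]
  exact Measurable.iSup fun n => hM.measurable_maxUpTo hm n

/-- Doob's weak type inequality for càdlàg martingales with values in a Banach space. -/
theorem IsCadlag.mul_measure_lt_maxUpTo_le [NormedSpace ℝ E] [CompleteSpace E]
    {m : MeasurableSpace X} {μ : Measure X} [IsProbabilityMeasure μ] {F : Filtration ℝ≥0 m}
    (hM : IsCadlag M) (hMF : Martingale M F μ) (t ε : ℝ≥0) :
    ε * μ {ω | (ε : ℝ≥0∞) < maxUpTo M t ω} ≤ ∫⁻ ω, ‖M t ω‖ₑ ∂μ := by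
  have hsub : ∀ i j, i ≤ j → (fun ω => ‖M i ω‖) ≤ᵐ[μ] μ[fun ω => ‖M j ω‖ | F i] := by
    intro i j hij
    filter_upwards [hMF.condExp_ae_eq hij, norm_condExp_le (μ := μ) (m := F i) (M j)] with ω h1 h2
    rwa [h1] at h2
  -- On a single grid the norms form a discrete submartingale, to which the discrete maximal
  -- inequality applies.
  have hfin : ∀ n K : ℕ,
      ε * μ {ω | ∃ k ≤ K, (ε : ℝ≥0∞) < ‖M (gridTime n k t) ω‖ₑ} ≤ ∫⁻ ω, ‖M t ω‖ₑ ∂μ := by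
    intro n K
    let G : Filtration ℕ m := ⟨fun k => F (gridTime n k t),
      fun k l hkl => F.mono (gridTime_mono n t hkl), fun k => F.le _⟩
    have hG : Submartingale (fun k ω => ‖M (gridTime n k t) ω‖) G μ :=
      ⟨fun k => (hMF.1 _).norm, fun k l hkl => hsub _ _ (gridTime_mono n t hkl),
        fun k => (hMF.integrable _).norm⟩
    have h := maximal_ineq hG (fun k ω => norm_nonneg _) (ε := ε) K
    have hset : {ω | ∃ k ≤ K, (ε : ℝ≥0∞) < ‖M (gridTime n k t) ω‖ₑ} ⊆
        {ω | (ε : ℝ) ≤ (Finset.range (K + 1)).sup' Finset.nonempty_range_add_one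
          fun k => ‖M (gridTime n k t) ω‖} := by
      rintro ω ⟨k, hk, hlt⟩
      refine le_trans ?_ (Finset.le_sup' (fun k => ‖M (gridTime n k t) ω‖)
        (Finset.mem_range.2 (Nat.lt_succ_of_le hk)))
      have h1 : ε < ‖M (gridTime n k t) ω‖₊ := by
        rw [enorm_eq_nnnorm] at hlt
        exact_mod_cast hlt
      exact_mod_cast h1.le
    calc ε * μ {ω | ∃ k ≤ K, (ε : ℝ≥0∞) < ‖M (gridTime n k t) ω‖ₑ}
        ≤ _ := mul_le_mul_right (measure_mono hset) _
      _ ≤ _ := h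
      _ ≤ ENNReal.ofReal (∫ ω, ‖M t ω‖ ∂μ) := by
        refine ENNReal.ofReal_le_ofReal ?_
        refine (setIntegral_le_integral (hMF.integrable _).norm
          (Eventually.of_forall fun ω => norm_nonneg _)).trans ?_
        rw [← integral_condExp (F.le (gridTime n K t)) (f := fun ω => ‖M t ω‖)]
        exact integral_mono_ae (hMF.integrable _).norm integrable_condExp
          (hsub _ _ (gridTime_le n K t))
      _ = ∫⁻ ω, ‖M t ω‖ₑ ∂μ := ofReal_integral_norm_eq_lintegral_enorm (hMF.integrable t)
  let A : ℕ → Set X := fun p => {ω | ∃ n ≤ p, ∃ k ≤ p, (ε : ℝ≥0∞) < ‖M (gridTime n k t) ω‖ₑ}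
  have hA : Monotone A := by
    rintro p q hpq ω ⟨n, hn, k, hk, h⟩
    exact ⟨n, hn.trans hpq, k, hk.trans hpq, h⟩
  have hAle : ∀ p, ε * μ (A p) ≤ ∫⁻ ω, ‖M t ω‖ₑ ∂μ := by
    intro p
    -- Dyadic grids are nested, so all points of level and index at most `p` appear on the grid of
    -- level `p` with index below `2 ^ p * (p + 1)`.
    refine le_trans (mul_le_mul_right (measure_mono ?_) _) (hfin p (2 ^ p * (p + 1)))
    rintro ω ⟨n, hn, k, hk, h⟩
    obtain ⟨j, rfl⟩ := Nat.exists_eq_add_of_le hn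
    obtain ⟨l, hl, hlt⟩ := exists_gridTime_add_eq n k j t
    refine ⟨l, ?_, hlt ▸ h⟩
    have h1 : l + 1 ≤ 2 ^ (n + j) * (n + j + 1) := by
      rw [hl]
      exact Nat.mul_le_mul (Nat.pow_le_pow_right two_pos (Nat.le_add_left j n)) (by omega)
    omega
  have hset : {ω | (ε : ℝ≥0∞) < maxUpTo M t ω} = ⋃ p, A p := by
    ext ω
    simp only [Set.mem_ofPred_eq, hM.maxUpTo_eq, lt_iSup_iff, Set.mem_iUnion, A]
    constructor
    · rintro ⟨n, k, h⟩
      exact ⟨max n k, n, le_max_left n k, k, le_max_right n k, h⟩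
    · rintro ⟨p, n, -, k, -, h⟩
      exact ⟨n, k, h⟩
  rw [hset, hA.measure_iUnion, ENNReal.mul_iSup]
  exact iSup_le hAle

end MaximalFunction

/-! ### Stopped processes and optional stopping -/

section Stopping

variable {X E : Type*} {τ : X → WithTop ℝ≥0}

/-- The time `min t (τ ω)`, as an element of `[0, ∞)`. -/
def minTime (τ : X → WithTop ℝ≥0) (t : ℝ≥0) (ω : X) : ℝ≥0 := (min (t : WithTop ℝ≥0) (τ ω)).untopA

lemma minTime_of_le {t : ℝ≥0} {ω : X} (h : (t : WithTop ℝ≥0) ≤ τ ω) : minTime τ t ω = t := by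
  rw [minTime, min_eq_left h]
  exact WithTop.untopD_coe _ _

lemma minTime_of_eq {b t : ℝ≥0} {ω : X} (h : τ ω = b) : minTime τ t ω = min t b := by
  simp only [minTime, h]
  rw [← WithTop.coe_min]
  exact WithTop.untopD_coe _ _

lemma minTime_le (τ : X → WithTop ℝ≥0) (t : ℝ≥0) (ω : X) : minTime τ t ω ≤ t := by
  cases h : τ ω with
  | top => exact (minTime_of_le (h ▸ le_top)).le
  | coe b => rw [minTime_of_eq h]; exact min_le_left _ _

lemma minTime_lt_iff {q t : ℝ≥0} (h : q ≤ t) (ω : X) : minTime τ t ω < q ↔ τ ω < q := by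
  cases hτ : τ ω with
  | top =>
    rw [minTime_of_le (hτ ▸ le_top)]
    exact iff_of_false (not_lt.2 h) not_top_lt
  | coe b =>
    rw [minTime_of_eq hτ, min_lt_iff, WithTop.coe_lt_coe]
    exact ⟨fun h' => h'.resolve_left (not_lt.2 h), Or.inr⟩

/-- The process `M`, stopped at the time `τ`. -/
def stopped (M : ℝ≥0 → X → E) (τ : X → WithTop ℝ≥0) (t : ℝ≥0) (ω : X) : E := M (minTime τ t ω) ω

lemma stopped_apply (M : ℝ≥0 → X → E) (τ : X → WithTop ℝ≥0) (t : ℝ≥0) (ω : X) :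
    stopped M τ t ω = M (minTime τ t ω) ω := rfl

lemma stopped_of_eq_top {M : ℝ≥0 → X → E} {ω : X} (h : τ ω = ⊤) (t : ℝ≥0) :
    stopped M τ t ω = M t ω := by
  rw [stopped_apply, minTime_of_le (h ▸ le_top)]

variable [NormedAddCommGroup E] {M : ℝ≥0 → X → E}

lemma IsCadlag.isCadlag_stopped (hM : IsCadlag M) (τ : X → WithTop ℝ≥0) :
    IsCadlag (stopped M τ) := by
  intro ω t
  cases hτ : τ ω with
  | top =>
    simp only [stopped_of_eq_top hτ]
    exact hM ω t
  | coe b =>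
    simp only [stopped_apply, minTime_of_eq hτ]
    constructor
    · have h1 : Tendsto (fun s => min s b) (𝓝[≥] t) (𝓝[≥] (min t b)) := by
        refine tendsto_nhdsWithin_iff.2 ⟨?_, ?_⟩
        · exact ((continuous_id.min continuous_const).tendsto t).mono_left nhdsWithin_le_nhds
        · filter_upwards [self_mem_nhdsWithin] with s hs
          exact min_le_min_right b hs
      exact (hM ω (min t b)).1.tendsto.comp h1
    · rcases le_or_gt t b with htb | hbt
      · obtain ⟨l, hl⟩ := (hM ω t).2
        refine ⟨l, hl.congr' ?_⟩
        filter_upwards [self_mem_nhdsWithin] with s hs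
        rw [min_eq_left (hs.le.trans htb)]
      · refine ⟨M b ω, tendsto_const_nhds.congr' ?_⟩
        filter_upwards [nhdsWithin_le_nhds (lt_mem_nhds hbt)] with s hs
        rw [min_eq_right hs.le]

variable {m : MeasurableSpace X} {F : Filtration ℝ≥0 m}

lemma measurable_minTime (hτ : IsStoppingTime F τ) (t : ℝ≥0) :
    Measurable[F t] (minTime τ t) := by
  let _ := F t
  refine measurable_of_Iio fun q => ?_
  rcases le_or_gt q t with h | h
  · have : minTime τ t ⁻¹' Set.Iio q = {ω | τ ω < q} := by
      ext ω; exact minTime_lt_iff h ω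
    rw [this]
    exact hτ.measurableSet_lt_le h
  · have : minTime τ t ⁻¹' Set.Iio q = Set.univ := by
      ext ω; simpa using (minTime_le τ t ω).trans_lt h
    rw [this]
    exact MeasurableSet.univ

lemma stronglyMeasurable_comp_nat {g : ℕ → X → E} (hg : ∀ k, StronglyMeasurable (g k))
    {κ : X → ℕ} (hκ : Measurable κ) : StronglyMeasurable fun ω => g (κ ω) ω := by
  borelize E
  refine stronglyMeasurable_iff_measurable_separable.2 ⟨?_, ?_⟩
  · exact (measurable_from_prod_countable_right (f := fun p : ℕ × X => g p.1 p.2)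
      fun k => (hg k).measurable).comp (hκ.prodMk measurable_id)
  · refine (TopologicalSpace.IsSeparable.iUnion fun k => (hg k).isSeparable_range).mono ?_
    rintro _ ⟨ω, rfl⟩
    exact Set.mem_iUnion.2 ⟨κ ω, ω, rfl⟩

/-- The stopped value is a limit of values at grid times chosen by an `F t`-measurable index; the
cap at `t` keeps those values `F t`-measurable. -/
lemma IsCadlag.stronglyAdapted_stopped (hM : IsCadlag M) (hMF : StronglyAdapted F M)
    (hτ : IsStoppingTime F τ) :
    StronglyAdapted F (stopped M τ) := by
  intro t
  refine stronglyMeasurable_of_tendsto (m := F t) atTop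
    (f := fun n ω => M (gridTime n ⌊2 ^ n * minTime τ t ω⌋₊ t) ω) (fun n => ?_) ?_
  · refine @stronglyMeasurable_comp_nat X E _ (F t) (fun k => M (gridTime n k t))
      (fun k => (hMF _).mono (F.mono (gridTime_le n k t))) _ ?_
    exact Nat.measurable_floor.comp ((measurable_minTime hτ t).const_mul _)
  · exact tendsto_pi_nhds.2 fun ω => hM.tendsto_gridTime ω (minTime_le τ t ω)

lemma isStoppingTime_gridTime (hτ : IsStoppingTime F τ) (n : ℕ) (t : ℝ≥0) :
    IsStoppingTime F fun ω => ((gridTime n ⌊2 ^ n * minTime τ t ω⌋₊ t : ℝ≥0) : WithTop ℝ≥0) := by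
  intro i
  simp only [WithTop.coe_le_coe]
  rcases le_or_gt t i with h | h
  · have : {ω | gridTime n ⌊2 ^ n * minTime τ t ω⌋₊ t ≤ i} = Set.univ := by
      ext ω; simpa using (gridTime_le _ _ _).trans h
    rw [this]
    exact MeasurableSet.univ
  · have hq : (⌊2 ^ n * i⌋₊ : ℝ≥0) / 2 ^ n ≤ i := by
      rw [div_le_iff₀ (by positivity), mul_comm i]
      exact Nat.floor_le zero_le
    -- The next grid point is at most `i` exactly when `τ` lies strictly before the last multiple of
    -- `2⁻¹ ^ n` not exceeding `i`, an event known at time `i`.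
    have : {ω | gridTime n ⌊2 ^ n * minTime τ t ω⌋₊ t ≤ i} =
        {ω | τ ω < ((⌊2 ^ n * i⌋₊ : ℝ≥0) / 2 ^ n : ℝ≥0)} := by
      ext ω
      rw [Set.mem_ofPred_eq, Set.mem_ofPred_eq, ← minTime_lt_iff (hq.trans h.le), gridTime,
        min_le_iff, or_iff_left (not_le.2 h), div_le_iff₀ (by positivity),
        lt_div_iff₀ (by positivity), mul_comm i, mul_comm _ (2 ^ n : ℝ≥0),
        ← Nat.floor_lt zero_le, ← Nat.succ_le_iff, ← Nat.cast_succ]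
      exact (Nat.le_floor_iff zero_le).symm
    rw [this]
    exact hτ.measurableSet_lt_le hq

lemma norm_le_toReal_maxFun {ω : X} (h : maxFun M ω < ∞) (t : ℝ≥0) :
    ‖M t ω‖ ≤ (maxFun M ω).toReal := by
  rw [← toReal_enorm]
  exact ENNReal.toReal_mono h.ne (enorm_le_maxFun M t ω)

variable {μ : Measure X} [NormedSpace ℝ E] [CompleteSpace E]

lemma MemHardy.maxFun_lt_top (hM : MemHardy F μ M) : ∀ᵐ ω ∂μ, maxFun M ω < ∞ :=
  ae_lt_top (hM.cadlag.measurable_maxFun fun t => (hM.martingale.1 t).mono (F.le t))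
    hM.max_integrable.ne

lemma MemHardy.integrable_maxFun (hM : MemHardy F μ M) :
    Integrable (fun ω => (maxFun M ω).toReal) μ :=
  integrable_toReal_of_lintegral_ne_top
    (hM.cadlag.measurable_maxFun fun t => (hM.martingale.1 t).mono (F.le t)).aemeasurable
    hM.max_integrable.ne

lemma MemHardy.integrable_stopped (hM : MemHardy F μ M) (hτ : IsStoppingTime F τ)
    (t : ℝ≥0) : Integrable (stopped M τ t) μ := by
  refine hM.integrable_maxFun.mono' ((hM.cadlag.stronglyAdapted_stopped hM.martingale.1
    hτ t).mono (F.le t)).aestronglyMeasurable ?_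
  filter_upwards [hM.maxFun_lt_top] with ω hω
  exact norm_le_toReal_maxFun hω _

variable [IsProbabilityMeasure μ]

/-- Optional stopping for martingales with integrable maximal function. -/
lemma MemHardy.integral_stopped (hM : MemHardy F μ M) (hτ : IsStoppingTime F τ) (t : ℝ≥0) :
    ∫ ω, stopped M τ t ω ∂μ = ∫ ω, M t ω ∂μ := by
  let r : ℕ → X → ℝ≥0 := fun n ω => gridTime n ⌊2 ^ n * minTime τ t ω⌋₊ t
  -- Discretized times take countably many values, where optional sampling is available; the
  -- integrable maximal function then dominates the passage to the limit.
  have hr : ∀ n, ∫ ω, M (r n ω) ω ∂μ = ∫ ω, M t ω ∂μ := by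
    intro n
    have hle : ∀ ω, ((r n ω : ℝ≥0) : WithTop ℝ≥0) ≤ t := fun ω =>
      WithTop.coe_le_coe.2 (gridTime_le _ _ _)
    have hst := isStoppingTime_gridTime hτ n t
    have h := hM.martingale.stoppedValue_ae_eq_condExp_of_le_const_of_countable_range hst hle (by
      refine (Set.countable_range fun k : ℕ => ((gridTime n k t : ℝ≥0) : WithTop ℝ≥0)).mono ?_
      rintro _ ⟨ω, rfl⟩
      exact ⟨_, rfl⟩)
    rw [← integral_condExp (hst.measurableSpace_le_of_le hle) (f := M t), ← integral_congr_ae h]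
    rfl
  have hlim : Tendsto (fun n => ∫ ω, M (r n ω) ω ∂μ) atTop
      (𝓝 (∫ ω, stopped M τ t ω ∂μ)) := by
    refine tendsto_integral_of_dominated_convergence _ (fun n => ?_) hM.integrable_maxFun
      (fun n => ?_) ?_
    · exact (stronglyMeasurable_comp_nat (g := fun k => M (gridTime n k t))
        (fun k => (hM.martingale.1 _).mono (F.le _)) (Nat.measurable_floor.comp
        (((measurable_minTime hτ t).mono (F.le t) le_rfl).const_mul _))).aestronglyMeasurable
    · filter_upwards [hM.maxFun_lt_top] with ω hω
      exact norm_le_toReal_maxFun hω _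
    · exact Eventually.of_forall fun ω => hM.cadlag.tendsto_gridTime ω (minTime_le τ t ω)
  simp only [hr] at hlim
  exact tendsto_nhds_unique hlim tendsto_const_nhds

/-- The stopped process of a martingale with integrable maximal function is a martingale. -/
theorem MemHardy.martingale_stopped (hM : MemHardy F μ M) (hτ : IsStoppingTime F τ) :
    Martingale (stopped M τ) F μ := by
  have hadp := hM.cadlag.stronglyAdapted_stopped hM.martingale.1 hτ
  refine ⟨hadp, fun s t hst => ?_⟩
  symm
  refine ae_eq_condExp_of_forall_setIntegral_eq (F.le s) (hM.integrable_stopped hτ t)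
    (fun A _ _ => (hM.integrable_stopped hτ s).integrableOn) (fun A hA _ => ?_)
    (hadp s).aestronglyMeasurable
  classical
  set B : Set X := A ∩ {ω | (s : WithTop ℝ≥0) < τ ω} with hB
  have hBs : MeasurableSet[F s] B := hA.inter (hτ.measurableSet_gt s)
  -- Moving `τ` back to `s` on `B` leaves the expectation of the stopped process unchanged. Off `B`
  -- the two stopped processes agree, so their integrals over `B` agree.
  let σ : X → WithTop ℝ≥0 := fun ω => if ω ∈ B then s else τ ω
  have hσ : IsStoppingTime F σ := by
    intro i
    rcases lt_or_ge i s with h | h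
    · have : {ω | σ ω ≤ i} = {ω | τ ω ≤ i} := by
        ext ω
        by_cases hω : ω ∈ B
        · have h1 : ¬ τ ω ≤ i := not_le.2 ((WithTop.coe_lt_coe.2 h).trans hω.2)
          simp only [σ, hω, h1, if_true, iff_false, Set.mem_ofPred_eq, WithTop.coe_le_coe, not_le, h]
        · simp [σ, hω]
      rw [this]
      exact hτ i
    · have : {ω | σ ω ≤ i} = B ∪ {ω | τ ω ≤ i} := by
        ext ω
        have h' : (s : WithTop ℝ≥0) ≤ i := WithTop.coe_le_coe.2 h
        by_cases hω : ω ∈ B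
        · have : σ ω = s := if_pos hω
          simpa [hω, this] using h'
        · simp [σ, hω]
      rw [this]
      exact (F.mono h _ hBs).union (hτ i)
  have hBm : MeasurableSet B := F.le s _ hBs
  have hAm : MeasurableSet A := F.le s _ hA
  have hI := hM.integrable_stopped hτ t
  have hIσ := hM.integrable_stopped hσ t
  have hIs := hM.integrable_stopped hτ s
  have hBeq : ∫ ω in B, stopped M τ s ω ∂μ = ∫ ω in B, stopped M τ t ω ∂μ := by
    have h1 : ∫ ω, stopped M σ t ω ∂μ = ∫ ω, stopped M τ t ω ∂μ := by
      rw [hM.integral_stopped hσ, hM.integral_stopped hτ]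
    rw [← integral_add_compl hBm hIσ, ← integral_add_compl hBm hI] at h1
    have h2 : ∫ ω in Bᶜ, stopped M σ t ω ∂μ = ∫ ω in Bᶜ, stopped M τ t ω ∂μ :=
      setIntegral_congr_fun hBm.compl fun ω hω => by
        have : σ ω = τ ω := if_neg hω
        simp only [stopped, minTime, this]
    have h3 : ∫ ω in B, stopped M σ t ω ∂μ = ∫ ω in B, stopped M τ s ω ∂μ :=
      setIntegral_congr_fun hBm fun ω hω => by
        have h4 : σ ω = s := if_pos hω
        simp only [stopped_apply]
        rw [minTime_of_eq h4, min_eq_right hst, minTime_of_le hω.2.le]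
    rw [h2, h3] at h1
    exact add_right_cancel h1
  rw [← integral_inter_add_sdiff (s := A) (hτ.measurableSet_gt s |> F.le s _) hIs.integrableOn,
    ← integral_inter_add_sdiff (s := A) (hτ.measurableSet_gt s |> F.le s _) hI.integrableOn, hBeq]
  congr 1
  refine setIntegral_congr_fun (hAm.diff (F.le s _ (hτ.measurableSet_gt s))) fun ω hω => ?_
  have h1 : τ ω ≤ s := not_lt.1 hω.2
  obtain ⟨b, hb⟩ := WithTop.ne_top_iff_exists.1 (ne_top_of_le_ne_top WithTop.coe_ne_top h1)
  rw [← hb, WithTop.coe_le_coe] at h1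
  simp only [stopped_apply]
  rw [minTime_of_eq hb.symm, minTime_of_eq hb.symm, min_eq_right h1,
    min_eq_right (h1.trans hst)]

end Stopping

/-! ### Triviality of the initial sigma-algebra -/

section Basis

variable {X E : Type*} {m : MeasurableSpace X} [NormedAddCommGroup E] {F : Filtration ℝ≥0 m}
  {μ : Measure X} {M : ℝ≥0 → X → E}

lemma IsStochasticBasis.isRightContinuous (hF : IsStochasticBasis F μ) : F.IsRightContinuous :=
  ⟨fun t => by rw [Filtration.rightCont_eq, ← hF.right_cont t]⟩

lemma IsStochasticBasis.measurableSet_of_null (hF : IsStochasticBasis F μ) {A : Set X}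
    (hA : MeasurableSet A) (h0 : μ A = 0) (t : ℝ≥0) : MeasurableSet[F t] A := by
  refine F.mono (zero_le (a := t)) A ?_
  rw [hF.zero_eq]
  exact MeasurableSpace.measurableSet_generateFrom ⟨hA, h0⟩

/-- Null and conull sets are stable under complements and countable unions. -/
lemma IsStochasticBasis.measure_eq_zero_or (hF : IsStochasticBasis F μ) {A : Set X}
    (hA : MeasurableSet[F 0] A) : μ A = 0 ∨ μ Aᶜ = 0 := by
  rw [hF.zero_eq] at hA
  refine MeasurableSpace.generateFrom_induction _ (fun A _ => μ A = 0 ∨ μ Aᶜ = 0)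
    (fun A hA _ => Or.inl hA.2) (Or.inl measure_empty) (fun A _ h => ?_) (fun A _ h => ?_) A hA
  · rw [compl_compl]
    exact h.symm
  · by_cases h' : ∃ n, μ (A n)ᶜ = 0
    · obtain ⟨n, hn⟩ := h'
      exact Or.inr (measure_mono_null (Set.compl_subset_compl.2 (Set.subset_iUnion A n)) hn)
    · push Not at h'
      exact Or.inl (measure_iUnion_null fun n => (h n).resolve_right (h' n))

/-- The event that `‖M 0‖` exceeds `C` is null or conull; if conull, the maximal function would
exceed `C` almost everywhere although its integral is at most `C`. -/
lemma MemHardy.enorm_zero_le [NormedSpace ℝ E] [CompleteSpace E] [IsProbabilityMeasure μ]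
    (hF : IsStochasticBasis F μ) (hM : MemHardy F μ M) {C : ℝ≥0} (hC : hardyNorm μ M ≤ C) :
    ∀ᵐ ω ∂μ, ‖M 0 ω‖ₑ ≤ C := by
  have hA : MeasurableSet[F 0] {ω | (C : ℝ≥0∞) < ‖M 0 ω‖ₑ} :=
    (hM.martingale.1 0).enorm measurableSet_Ioi
  rcases hF.measure_eq_zero_or hA with h | h
  · simpa [ae_iff] using h
  · have h1 : ∀ᵐ ω ∂μ, (C : ℝ≥0∞) < maxFun M ω := by
      have h2 : ∀ᵐ ω ∂μ, (C : ℝ≥0∞) < ‖M 0 ω‖ₑ := ae_iff.2 h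
      filter_upwards [h2] with ω hω using hω.trans_le (enorm_le_maxFun M 0 ω)
    have h3 := ae_eq_of_ae_le_of_lintegral_le (f := fun _ => (C : ℝ≥0∞)) (g := maxFun M)
      (h1.mono fun ω h => h.le) (by simp)
      (hM.cadlag.measurable_maxFun fun t => (hM.martingale.1 t).mono (F.le t)).aemeasurable
      (by simpa [hardyNorm] using hC)
    have h4 : ∀ᵐ ω ∂μ, False := by
      filter_upwards [h1, h3] with ω h5 h6
      exact absurd h6 h5.ne
    exact absurd (by simpa using h4) (IsProbabilityMeasure.ne_zero μ)

end Basis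

/-! ### Exit times from balls -/

section ExitTime

variable {X E : Type*} {m : MeasurableSpace X} [NormedAddCommGroup E] {F : Filtration ℝ≥0 m}
  {μ : Measure X} {M : ℝ≥0 → X → E}

/-- The first time at which the norm of `M` exceeds `r`. -/
def exitTime (M : ℝ≥0 → X → E) (r : ℝ≥0) : X → WithTop ℝ≥0 :=
  hittingAfter (fun t ω => ‖M t ω‖₊) (Set.Ioi r) 0

/-- By right-continuity of the filtration it is enough to treat strict inequalities. The exterior of
the ball is open, so an exit before `i` is visible at a grid time before `i`. -/
lemma IsCadlag.isStoppingTime_exitTime (hF : IsStochasticBasis F μ) (hM : IsCadlag M)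
    (hMF : StronglyAdapted F M) (r : ℝ≥0) : IsStoppingTime F (exitTime M r) := by
  have := hF.isRightContinuous
  refine isStoppingTime_of_measurableSet_lt_of_isRightContinuous fun i => ?_
  have : {ω | exitTime M r ω < i} = ⋃ n, ⋃ k, ⋃ (_ : gridTime n k i < i),
      {ω | r < ‖M (gridTime n k i) ω‖₊} := by
    ext ω
    simp only [exitTime, Set.mem_ofPred_eq, hittingAfter_lt_iff, Set.mem_iUnion, exists_prop,
      Set.mem_Ico, Set.mem_Ioi]
    constructor
    · rintro ⟨j, ⟨-, hj⟩, hr⟩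
      have h1 : ∀ᶠ n in atTop, gridTime n ⌊2 ^ n * j⌋₊ i < i :=
        ((tendsto_gridTime_floor hj.le).mono_right nhdsWithin_le_nhds).eventually
          (gt_mem_nhds hj)
      have h2 := (hM.tendsto_gridTime ω hj.le).nnnorm.eventually (lt_mem_nhds hr)
      obtain ⟨n, hn1, hn2⟩ := (h1.and h2).exists
      exact ⟨n, _, hn1, hn2⟩
    · rintro ⟨n, k, h1, h2⟩
      exact ⟨_, ⟨zero_le, h1⟩, h2⟩
  rw [this]
  refine MeasurableSet.iUnion fun n => MeasurableSet.iUnion fun k => MeasurableSet.iUnion fun h => ?_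
  exact F.mono h.le _ ((hMF (gridTime n k i)).nnnorm.measurable measurableSet_Ioi)

lemma nnnorm_le_of_lt_exitTime {r : ℝ≥0} {ω : X} {t : ℝ≥0} (h : t < exitTime M r ω) :
    ‖M t ω‖₊ ≤ r :=
  not_lt.1 (notMem_of_lt_hittingAfter h zero_le)

lemma lt_maxFun_of_exitTime_ne_top {r : ℝ≥0} {ω : X} (h : exitTime M r ω ≠ ⊤) :
    (r : ℝ≥0∞) < maxFun M ω := by
  rw [exitTime, ne_eq, hittingAfter_eq_top_iff] at h
  push Not at h
  obtain ⟨t, -, ht⟩ := h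
  refine lt_of_lt_of_le ?_ (enorm_le_maxFun M t ω)
  rw [enorm_eq_nnnorm]
  exact ENNReal.coe_lt_coe.2 ht

/-- Before the exit the norm is at most both `M*` and `r`. At a positive exit time this passes to
the left limit, and the jump accounts for the rest; an exit at time `0` has no left limit and is
covered by `M 0`. -/
lemma IsCadlag.enorm_stopped_exitTime_le (hM : IsCadlag M) (r t : ℝ≥0) (ω : X) :
    ‖stopped M (exitTime M r) t ω‖ₑ ≤
      min (maxFun M ω) r + ‖M 0 ω‖ₑ + ‖valueAt (jump M) (exitTime M r) ω‖ₑ := by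
  have hlt : ∀ s : ℝ≥0, s < exitTime M r ω → ‖M s ω‖ₑ ≤ min (maxFun M ω) r := fun s hs =>
    le_min (enorm_le_maxFun M s ω) (by
      rw [enorm_eq_nnnorm]
      exact ENNReal.coe_le_coe.2 (nnnorm_le_of_lt_exitTime hs))
  rw [stopped_apply]
  rcases lt_or_ge (t : WithTop ℝ≥0) (exitTime M r ω) with h | h
  · rw [minTime_of_le h.le]
    exact (hlt t h).trans (by rw [add_assoc]; exact le_self_add)
  · obtain ⟨b, hb⟩ := WithTop.ne_top_iff_exists.1 (ne_top_of_le_ne_top WithTop.coe_ne_top h)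
    rw [← hb, WithTop.coe_le_coe] at h
    have hv : valueAt (jump M) (exitTime M r) ω = jump M b ω := by
      simp only [valueAt, ← hb]
    rw [minTime_of_eq hb.symm, min_eq_right h, hv]
    rcases eq_or_ne b 0 with rfl | hb0
    · rw [add_right_comm]
      exact le_add_self
    · have hne : (𝓝[<] b).NeBot := nhdsLT_neBot_of_exists_lt ⟨0, pos_iff_ne_zero.2 hb0⟩
      obtain ⟨l, hl⟩ := (hM ω b).2
      have hl' : ‖l‖ₑ ≤ min (maxFun M ω) r := by
        refine le_of_tendsto hl.enorm ?_
        filter_upwards [self_mem_nhdsWithin] with s hs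
        exact hlt s (by rw [← hb]; exact WithTop.coe_lt_coe.2 hs)
      have hj : M b ω = l + jump M b ω := by
        rw [jump, leftLim_eq_of_tendsto hl, add_sub_cancel]
      calc ‖M b ω‖ₑ ≤ ‖l‖ₑ + ‖jump M b ω‖ₑ := by
            conv_lhs => rw [hj]
            exact enorm_add_le _ _
        _ ≤ _ := by
          gcongr
          exact hl'.trans le_self_add

end ExitTime

/-! ### Subsequence splitting -/

section KadecPelczynski

variable {X : Type*} {m : MeasurableSpace X}

/-- Subsequence splitting: a sequence bounded in `L¹` has a subsequence whose suitable truncations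
at the levels `2 ^ j` are uniformly integrable. -/
theorem exists_strictMono_lintegral_min_tsub_le (μ : Measure X) [IsProbabilityMeasure μ]
    {f : ℕ → X → ℝ≥0∞} (hf : ∀ n, Measurable (f n)) {C : ℝ≥0}
    (hC : ∀ n, ∫⁻ ω, f n ω ∂μ ≤ C) :
    ∃ φ : ℕ → ℕ, StrictMono φ ∧ ∀ ε > 0, ∃ K : ℝ≥0, ∀ j : ℕ,
      ∫⁻ ω, (min (f (φ j) ω) ((2 ^ j : ℝ≥0) : ℝ≥0∞) - K) ∂μ ≤ ε := by
  let a : ℕ → ℕ → ℝ≥0∞ := fun n K => ∫⁻ ω, min (f n ω) K ∂μ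
  have haC : ∀ n K, a n K ≤ C := fun n K => (lintegral_mono fun ω => min_le_left _ _).trans (hC n)
  have hamono : ∀ n, Monotone (a n) := fun n K L h =>
    lintegral_mono fun ω => min_le_min_left _ (by exact_mod_cast h)
  -- Compactness of the countable product of copies of `[0, ∞]` makes the truncated integrals
  -- converge at all integer levels at once.
  obtain ⟨A, ψ, hψ, hA⟩ := CompactSpace.tendsto_subseq a
  have hA' : ∀ K, Tendsto (fun n => a (ψ n) K) atTop (𝓝 (A K)) := fun K =>
    (tendsto_pi_nhds.1 hA) K
  have hAC : ∀ K, A K ≤ C := fun K => le_of_tendsto' (hA' K) fun n => haC _ _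
  have hAmono : Monotone A := fun K L h => le_of_tendsto_of_tendsto' (hA' K) (hA' L)
    fun n => hamono _ h
  have hAsup : Tendsto A atTop (𝓝 (⨆ K, A K)) := tendsto_atTop_iSup hAmono
  have hsup : ⨆ K, A K ≠ ∞ := ne_top_of_le_ne_top ENNReal.coe_ne_top (iSup_le hAC)
  obtain ⟨φ, hφ, hφA⟩ := extraction_forall_of_eventually'
    (P := fun j n => ∀ K ≤ 2 ^ j, a (ψ n) K ∈ Set.Icc (A K - 2⁻¹ ^ j) (A K + 2⁻¹ ^ j)) (by
      intro j
      have : ∀ᶠ n in atTop, ∀ K ∈ Finset.range (2 ^ j + 1),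
          a (ψ n) K ∈ Set.Icc (A K - 2⁻¹ ^ j) (A K + 2⁻¹ ^ j) := by
        rw [Finset.eventually_all]
        intro K _
        exact (ENNReal.tendsto_nhds (ne_top_of_le_ne_top ENNReal.coe_ne_top (hAC K))).1 (hA' K) _
          (ENNReal.pow_pos (by simp) _)
      obtain ⟨N, hN⟩ := this.exists_forall_of_atTop
      exact ⟨N, fun n hn K hK => hN n hn K (Finset.mem_range.2 (Nat.lt_succ_of_le hK))⟩)
  refine ⟨ψ ∘ φ, hψ.comp hφ, fun ε hε => ?_⟩
  have hε2 : (0 : ℝ≥0∞) < ε / 2 := ENNReal.div_pos hε.ne' (by simp)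
  have hε4 : (0 : ℝ≥0∞) < ε / 2 / 2 := ENNReal.div_pos hε2.ne' (by simp)
  have h1 : ∀ᶠ K in atTop, ⨆ K, A K ≤ A K + ε / 2 := by
    have h2 : Tendsto (fun K => A K + ε / 2) atTop (𝓝 ((⨆ K, A K) + ε / 2)) :=
      hAsup.add tendsto_const_nhds
    filter_upwards [h2.eventually (lt_mem_nhds (ENNReal.lt_add_right hsup hε2.ne'))] with K hK
      using hK.le
  have h3 : ∀ᶠ J : ℕ in atTop, (2⁻¹ : ℝ≥0∞) ^ J ≤ ε / 2 / 2 := by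
    have := (ENNReal.tendsto_pow_atTop_nhds_zero_of_lt_one (r := 2⁻¹)
      (ENNReal.inv_lt_one.2 ENNReal.one_lt_two)).eventually (gt_mem_nhds hε4)
    filter_upwards [this] with J hJ using hJ.le
  obtain ⟨J, hJ⟩ := h3.exists
  obtain ⟨K, hK, hKJ⟩ := (h1.and (eventually_ge_atTop (2 ^ J))).exists
  refine ⟨K, fun j => ?_⟩
  rcases lt_or_ge (2 ^ j) K with hj | hj
  · have hj' : ((2 ^ j : ℝ≥0) : ℝ≥0∞) ≤ ((K : ℝ≥0) : ℝ≥0∞) := by exact_mod_cast hj.le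
    have : ∀ ω, min (f (ψ (φ j)) ω) ((2 ^ j : ℝ≥0) : ℝ≥0∞) - ((K : ℝ≥0) : ℝ≥0∞) = 0 := fun ω =>
      tsub_eq_zero_of_le ((min_le_right _ _).trans hj')
    simp only [Function.comp_apply, this, lintegral_zero, zero_le]
  · have hJj : J ≤ j := (Nat.pow_le_pow_iff_right (by norm_num)).1 (hKJ.trans hj)
    have hδ : (2⁻¹ : ℝ≥0∞) ^ j ≤ ε / 2 / 2 :=
      (pow_le_pow_of_le_one zero_le (ENNReal.inv_le_one.2 one_le_two) hJj).trans hJ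
    have hcast : ((2 ^ j : ℝ≥0) : ℝ≥0∞) = ((2 ^ j : ℕ) : ℝ≥0∞) := by push_cast; rfl
    have hcK : ((K : ℝ≥0) : ℝ≥0∞) = (K : ℝ≥0∞) := by simp
    have hKj : (K : ℝ≥0∞) ≤ ((2 ^ j : ℕ) : ℝ≥0∞) := by exact_mod_cast hj
    -- The excess of `min f (2 ^ j)` over `K` is bounded by a difference of truncations. Its
    -- integral is within `2 * 2⁻¹ ^ j` of `A (2 ^ j) - A K`, which is small because `A` is
    -- increasing and bounded.
    have hle : ∀ ω, min (f (ψ (φ j)) ω) ((2 ^ j : ℝ≥0) : ℝ≥0∞) - ((K : ℝ≥0) : ℝ≥0∞) ≤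
        min (f (ψ (φ j)) ω) ((2 ^ j : ℕ) : ℝ≥0∞) - min (f (ψ (φ j)) ω) (K : ℝ≥0∞) := by
      intro ω
      rw [hcast, hcK]
      exact tsub_le_tsub_left (min_le_right _ _) _
    refine (lintegral_mono hle).trans ?_
    rw [lintegral_sub ((hf _).min measurable_const)
      (ne_top_of_le_ne_top ENNReal.coe_ne_top (haC (ψ (φ j)) K))
      (Eventually.of_forall fun ω => min_le_min_left _ hKj)]
    refine tsub_le_iff_left.2 ?_
    have h4 := (hφA j (2 ^ j) le_rfl).2
    have h5 := tsub_le_iff_right.1 (hφA j K hj).1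
    calc a (ψ (φ j)) (2 ^ j) ≤ A (2 ^ j) + 2⁻¹ ^ j := h4
      _ ≤ (A K + ε / 2) + 2⁻¹ ^ j := by gcongr; exact (le_iSup A _).trans hK
      _ ≤ (a (ψ (φ j)) K + 2⁻¹ ^ j + ε / 2) + 2⁻¹ ^ j := by gcongr
      _ ≤ (a (ψ (φ j)) K + ε / 2 / 2 + ε / 2) + ε / 2 / 2 := by gcongr
      _ = a (ψ (φ j)) K + ((ε / 2 / 2 + ε / 2 / 2) + ε / 2) := by ring
      _ = a (ψ (φ j)) K + ε := by rw [ENNReal.add_halves, ENNReal.add_halves]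

end KadecPelczynski

/-! ### Uniform integrability through excesses -/

section Excess

variable {X E ι : Type*} {m : MeasurableSpace X} [NormedAddCommGroup E]

/-- The excess over a level is convenient because it is subadditive when levels are added, so bounds
for summands combine directly. -/
lemma UniformIntegrable.exists_lintegral_tsub_le {μ : Measure X} {f : ι → X → E}
    (hf : UniformIntegrable f 1 μ) {ε : ℝ≥0∞} (hε : 0 < ε) :
    ∃ K : ℝ≥0, ∀ i, ∫⁻ ω, (‖f i ω‖ₑ - K) ∂μ ≤ ε := by
  obtain ⟨r, hr0, hr⟩ := ENNReal.lt_iff_exists_nnreal_btwn.1 hε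
  obtain ⟨K, hK⟩ := hf.spec one_ne_zero ENNReal.one_ne_top (ε := r) (by exact_mod_cast hr0)
  refine ⟨K, fun i => ?_⟩
  have h := hK i
  rw [eLpNorm_one_eq_lintegral_enorm, ENNReal.ofReal_coe_nnreal] at h
  refine le_trans (lintegral_mono fun ω => ?_) (h.trans hr.le)
  by_cases hω : K ≤ ‖f i ω‖₊
  · rw [Set.indicator_of_mem (by exact hω)]
    exact tsub_le_self
  · have : ‖f i ω‖ₑ ≤ K := by
      rw [enorm_eq_nnnorm]
      exact ENNReal.coe_le_coe.2 (not_le.1 hω).le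
    rw [tsub_eq_zero_of_le this]
    exact zero_le

end Excess

/-! ### Completeness of the u.c.p. topology -/

section Ucp

variable {X E : Type*} [NormedAddCommGroup E] {M N : ℝ≥0 → X → E}

lemma isCadlag_zero : IsCadlag (0 : ℝ≥0 → X → E) :=
  fun _ _ => ⟨continuousWithinAt_const, 0, tendsto_const_nhds⟩

lemma IsCadlag.add (hM : IsCadlag M) (hN : IsCadlag N) : IsCadlag (M + N) := by
  intro ω t
  obtain ⟨l, hl⟩ := (hM ω t).2
  obtain ⟨l', hl'⟩ := (hN ω t).2
  exact ⟨(hM ω t).1.add (hN ω t).1, l + l', hl.add hl'⟩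

lemma IsCadlag.sub (hM : IsCadlag M) (hN : IsCadlag N) : IsCadlag (M - N) := by
  intro ω t
  obtain ⟨l, hl⟩ := (hM ω t).2
  obtain ⟨l', hl'⟩ := (hN ω t).2
  exact ⟨(hM ω t).1.sub (hN ω t).1, l - l', hl.sub hl'⟩

lemma IsCadlag.const_smul [NormedSpace ℝ E] (hM : IsCadlag M) (a : ℝ) : IsCadlag (a • M) := by
  intro ω t
  obtain ⟨l, hl⟩ := (hM ω t).2
  exact ⟨(hM ω t).1.const_smul a, a • l, hl.const_smul a⟩

/-- Stated for an arbitrary filter so as to give both right-continuity and left limits of a uniform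
limit of paths. -/
lemma exists_tendsto_of_uniform_approx [CompleteSpace E] {α : Type*} {l : Filter α} {u : α → E}
    (h : ∀ ε > 0, ∃ v : α → E, (∃ a, Tendsto v l (𝓝 a)) ∧ ∀ᶠ x in l, dist (v x) (u x) ≤ ε) :
    ∃ a, Tendsto u l (𝓝 a) := by
  rcases l.eq_or_neBot with rfl | hl
  · exact ⟨0, tendsto_bot⟩
  refine cauchy_map_iff_exists_tendsto.1 (Metric.cauchy_iff.2 ⟨inferInstance, fun ε hε => ?_⟩)
  obtain ⟨v, ⟨a, ha⟩, hv⟩ := h (ε / 5) (by positivity)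
  have h2 := hv.and (ha.eventually (Metric.ball_mem_nhds a (show 0 < ε / 5 by positivity)))
  refine ⟨u '' {x | dist (v x) (u x) ≤ ε / 5 ∧ v x ∈ Metric.ball a (ε / 5)}, image_mem_map h2, ?_⟩
  rintro _ ⟨x, ⟨hx1, hx2⟩, rfl⟩ _ ⟨y, ⟨hy1, hy2⟩, rfl⟩
  rw [Metric.mem_ball] at hx2 hy2
  have := dist_triangle4 (u x) (v x) (v y) (u y)
  have h3 := dist_triangle_right (v x) (v y) a
  rw [dist_comm (u x) (v x)] at this
  linarith

variable {m : MeasurableSpace X} {F : Filtration ℝ≥0 m} {μ : Measure X}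

/-- Pathwise almost sure convergence of the maximal functions implies u.c.p. convergence. -/
lemma tendsto_ucpDist_zero [IsProbabilityMeasure μ] {N : ℕ → ℝ≥0 → X → E} {L : ℝ≥0 → X → E}
    (hm : ∀ k t, Measurable (maxUpTo (N k - L) t))
    (h : ∀ᵐ ω ∂μ, ∀ n : ℕ, Tendsto (fun k => maxUpTo (N k - L) n ω) atTop (𝓝 0)) :
    Tendsto (fun k => ucpDist μ (N k) L) atTop (𝓝 0) := by
  have hin : ∀ n : ℕ, Tendsto
      (fun k => ∫⁻ ω, min 1 (maxUpTo (N k - L) ((n : ℝ≥0) + 1) ω) ∂μ) atTop (𝓝 0) := by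
    intro n
    have := tendsto_lintegral_of_dominated_convergence (μ := μ)
      (F := fun k ω => min 1 (maxUpTo (N k - L) ((n : ℝ≥0) + 1) ω)) (f := fun _ => 0)
      (fun _ => 1) (fun k => measurable_const.min (hm k _))
      (fun k => Eventually.of_forall fun ω => min_le_left _ _) (by simp) (by
        filter_upwards [h] with ω hω
        have h1 := hω (n + 1)
        push_cast at h1
        simpa using (tendsto_const_nhds (x := (1 : ℝ≥0∞))).min h1)
    simpa using this
  -- The series is an integral for counting measure, dominated by the geometric weights.
  have := tendsto_lintegral_of_dominated_convergence (μ := Measure.count (α := ℕ))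
    (F := fun k n => (2⁻¹ : ℝ≥0∞) ^ (n + 1) *
      ∫⁻ ω, min 1 (maxUpTo (N k - L) ((n : ℝ≥0) + 1) ω) ∂μ) (f := fun _ => 0)
    (fun n => (2⁻¹ : ℝ≥0∞) ^ (n + 1)) (fun k => measurable_of_countable _)
    (fun k => Eventually.of_forall fun n => by
      refine (mul_le_mul_right (lintegral_mono fun ω => min_le_left _ _) _).trans ?_
      simp) (by
      rw [lintegral_count]
      simp only [pow_succ, ENNReal.tsum_mul_right, ENNReal.tsum_geometric]
      simp) (Eventually.of_forall fun n => by
      have := ENNReal.Tendsto.const_mul (a := (2⁻¹ : ℝ≥0∞) ^ (n + 1)) (hin n)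
        (Or.inr (by simp))
      simpa using this)
  simpa only [lintegral_count, tsum_zero, ucpDist] using this

/-- A sequence of adapted càdlàg processes which is Cauchy in the u.c.p. topology has a
subsequence which converges. -/
theorem exists_subseq_tendstoUcp [CompleteSpace E] [IsProbabilityMeasure μ]
    (hF : IsStochasticBasis F μ) {N : ℕ → ℝ≥0 → X → E} (hadp : ∀ k, StronglyAdapted F (N k))
    (hcad : ∀ k, IsCadlag (N k))
    (hc : ∀ T : ℕ, ∀ ε : ℝ≥0, 0 < ε → ∃ n, ∀ k l, n ≤ k → n ≤ l →
      μ {ω | (ε : ℝ≥0∞) < maxUpTo (N k - N l) T ω} ≤ ε) :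
    ∃ φ : ℕ → ℕ, StrictMono φ ∧ ∃ L, TendstoUcp F μ (N ∘ φ) L := by
  obtain ⟨φ, hφ, hφP⟩ := extraction_forall_of_eventually'
    (P := fun i n => ∀ k l, n ≤ k → n ≤ l →
      μ {ω | ((2⁻¹ ^ i : ℝ≥0) : ℝ≥0∞) < maxUpTo (N k - N l) i ω} ≤ ((2⁻¹ ^ i : ℝ≥0) : ℝ≥0∞))
    (fun i => by
      obtain ⟨n, hn⟩ := hc i (2⁻¹ ^ i) (by positivity)
      exact ⟨n, fun k hk a b ha hb => hn a b (hk.trans ha) (hk.trans hb)⟩)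
  have hmeas : ∀ k t, StronglyMeasurable (N k t) := fun k t => (hadp k t).mono (F.le t)
  let A : ℕ → Set X := fun i =>
    {ω | ((2⁻¹ ^ i : ℝ≥0) : ℝ≥0∞) < maxUpTo (N (φ i) - N (φ (i + 1))) i ω}
  have hAm : ∀ i, MeasurableSet (A i) := fun i =>
    measurableSet_lt measurable_const (((hcad _).sub (hcad _)).measurable_maxUpTo
      (fun t => (hmeas _ t).sub (hmeas _ t)) i)
  have hAsum : ∑' i, μ (A i) ≠ ∞ := by
    refine ne_top_of_le_ne_top (b := ∑' i : ℕ, (2⁻¹ : ℝ≥0∞) ^ i) ?_ (ENNReal.tsum_le_tsum fun i => ?_)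
    · rw [ENNReal.tsum_geometric]; simp
    · refine (hφP i _ _ le_rfl (hφ.monotone i.le_succ)).trans (le_of_eq ?_)
      rw [ENNReal.coe_pow, ENNReal.coe_inv two_ne_zero]; rfl
  -- By Borel–Cantelli almost every path converges locally uniformly at a geometric rate. The conull
  -- set `G` belongs to every `F t`, so setting the limit to `0` off `G` preserves adaptedness and
  -- makes every path càdlàg.
  let G : Set X := {ω | ∀ᶠ i in atTop, ω ∉ A i}
  have hG : ∀ᵐ ω ∂μ, ω ∈ G := ae_eventually_notMem hAsum
  have hGm : MeasurableSet G := by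
    have : G = ⋃ n : ℕ, ⋂ i : ℕ, ⋂ (_ : n ≤ i), (A i)ᶜ := by
      ext ω; simp [G, eventually_atTop]
    rw [this]
    exact MeasurableSet.iUnion fun n => MeasurableSet.iInter fun i => MeasurableSet.iInter fun _ =>
      (hAm i).compl
  have hGF : ∀ t, MeasurableSet[F t] G := fun t => by
    have := (hF.measurableSet_of_null hGm.compl (ae_iff.1 hG) t).compl
    rwa [compl_compl] at this
  have hdist : ∀ ω ∈ G, ∀ T : ℝ≥0, ∃ J : ℕ, ∀ s ≤ T, ∀ i,
      dist (N (φ (J + i)) s ω) (N (φ (J + (i + 1))) s ω) ≤ 2 * 2⁻¹ ^ J / 2 / 2 ^ i := by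
    intro ω hω T
    obtain ⟨I, hI⟩ := eventually_atTop.1 hω
    obtain ⟨n, hn⟩ := exists_nat_ge T
    refine ⟨max I n, fun s hs i => ?_⟩
    have h1 := hI (max I n + i) ((le_max_left I n).trans (Nat.le_add_right _ _))
    have h2 : maxUpTo (N (φ (max I n + i)) - N (φ (max I n + i + 1))) ↑(max I n + i) ω ≤
      ((2⁻¹ ^ (max I n + i) : ℝ≥0) : ℝ≥0∞) := not_lt.1 h1
    have h3 : s ≤ ((max I n + i : ℕ) : ℝ≥0) := (hs.trans hn).trans
      (by exact_mod_cast (le_max_right I n).trans (Nat.le_add_right _ _))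
    have h4 := (enorm_le_maxUpTo _ h3 ω).trans h2
    rw [enorm_eq_nnnorm, ENNReal.coe_le_coe] at h4
    rw [dist_eq_norm]
    have h5 : ‖N (φ (max I n + i)) s ω - N (φ (max I n + (i + 1))) s ω‖ ≤
        (2⁻¹ : ℝ) ^ (max I n + i) := by exact_mod_cast h4
    refine h5.trans (le_of_eq ?_)
    rw [pow_add, inv_pow 2 i]
    field_simp
  have hlim : ∀ t ω, ∃ a, ω ∈ G → Tendsto (fun i => N (φ i) t ω) atTop (𝓝 a) := by
    intro t ω
    by_cases hω : ω ∈ G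
    · obtain ⟨J, hJ⟩ := hdist ω hω t
      obtain ⟨a, ha⟩ := cauchySeq_tendsto_of_complete (cauchySeq_of_le_geometric_two (hJ t le_rfl))
      refine ⟨a, fun _ => (tendsto_add_atTop_iff_nat J).1 ?_⟩
      simpa only [add_comm J] using ha
    · exact ⟨0, fun h => absurd h hω⟩
  choose R hR using hlim
  let L : ℝ≥0 → X → E := fun t => G.indicator (R t)
  have hLG : ∀ ω ∈ G, ∀ t, L t ω = R t ω := fun ω hω t => Set.indicator_of_mem hω _
  have hLG' : ∀ ω ∉ G, ∀ t, L t ω = 0 := fun ω hω t => Set.indicator_of_notMem hω _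
  have hunif : ∀ ω ∈ G, ∀ T : ℝ≥0, ∃ J : ℕ, ∀ s ≤ T, ∀ i,
      dist (N (φ (J + i)) s ω) (L s ω) ≤ 2 * 2⁻¹ ^ J / 2 ^ i := by
    intro ω hω T
    obtain ⟨J, hJ⟩ := hdist ω hω T
    refine ⟨J, fun s hs i => ?_⟩
    refine dist_le_of_le_geometric_two_of_tendsto (f := fun i => N (φ (J + i)) s ω) (hJ s hs) ?_ i
    rw [hLG ω hω]
    have := (tendsto_add_atTop_iff_nat J).2 (hR s ω hω)
    simpa only [add_comm J] using this
  have hsmall : ∀ J : ℕ, Tendsto (fun i : ℕ => 2 * (2⁻¹ : ℝ) ^ J / 2 ^ i) atTop (𝓝 0) := fun J =>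
    tendsto_const_nhds.div_atTop (tendsto_pow_atTop_atTop_of_one_lt one_lt_two)
  have hLcad : IsCadlag L := by
    intro ω t
    by_cases hω : ω ∈ G
    · obtain ⟨J, hJ⟩ := hunif ω hω (t + 1)
      have key : ∀ l : Filter ℝ≥0, (∀ᶠ s in l, s ≤ t + 1) →
          (∀ k, ∃ a, Tendsto (fun s => N k s ω) l (𝓝 a)) →
          ∃ a, Tendsto (fun s => L s ω) l (𝓝 a) := by
        intro l hl hk
        refine exists_tendsto_of_uniform_approx fun ε hε => ?_
        obtain ⟨i, hi⟩ := ((hsmall J).eventually (gt_mem_nhds hε)).exists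
        exact ⟨fun s => N (φ (J + i)) s ω, hk _, hl.mono fun s hs => (hJ s hs i).trans hi.le⟩
      have hnear : ∀ᶠ s in 𝓝 t, s ≤ t + 1 :=
        ge_mem_nhds (lt_add_of_pos_right t one_pos)
      constructor
      · obtain ⟨a, ha⟩ := key (𝓝[≥] t) (nhdsWithin_le_nhds hnear)
          fun k => ⟨_, (hcad k ω t).1⟩
        have h1 : Tendsto (fun s => L s ω) (pure t) (𝓝 a) :=
          ha.mono_left (pure_le_nhdsWithin Set.self_mem_Ici)
        have h2 : L t ω = a := tendsto_nhds_unique (tendsto_pure_nhds _ _) h1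
        rw [ContinuousWithinAt, h2]
        exact ha
      · exact key (𝓝[<] t) (nhdsWithin_le_nhds hnear) fun k => (hcad k ω t).2
    · simp only [hLG' ω hω]
      exact ⟨continuousWithinAt_const, 0, tendsto_const_nhds⟩
  have hLadp : StronglyAdapted F L := by
    intro t
    refine stronglyMeasurable_of_tendsto (m := F t) atTop
      (f := fun i => G.indicator (N (φ i) t)) (fun i => (hadp _ t).indicator (hGF t)) ?_
    refine tendsto_pi_nhds.2 fun ω => ?_
    by_cases hω : ω ∈ G
    · simpa [L, hω] using hR t ω hω
    · simp [L, hω]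
  refine ⟨φ, hφ, L, fun k => hadp _, fun k => hcad _, hLadp, hLcad, tendsto_ucpDist_zero ?_ ?_⟩
  · exact fun k t => ((hcad _).sub hLcad).measurable_maxUpTo
      (fun t => (hmeas _ t).sub ((hLadp t).mono (F.le t))) t
  · filter_upwards [hG] with ω hω n
    obtain ⟨J, hJ⟩ := hunif ω hω n
    rw [← tendsto_add_atTop_iff_nat J]
    have h1 : Tendsto (fun i => ENNReal.ofReal (2 * (2⁻¹ : ℝ) ^ J / 2 ^ i)) atTop (𝓝 0) := by
      simpa using ENNReal.tendsto_ofReal (hsmall J)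
    refine tendsto_of_tendsto_of_tendsto_of_le_of_le tendsto_const_nhds h1
      (fun i => zero_le) (fun i => iSup₂_le fun s hs => ?_)
    have h2 := hJ s hs i
    rw [add_comm J, dist_eq_norm] at h2
    rw [← ofReal_norm]
    exact ENNReal.ofReal_le_ofReal h2

end Ucp

/-! ### Transfer between stopped and unstopped martingales -/

section Combination

variable {X E : Type*} {m : MeasurableSpace X} [NormedAddCommGroup E] [NormedSpace ℝ E]
  {F : Filtration ℝ≥0 m} {μ : Measure X}

lemma linearCombination_process_apply (P : ℕ → ℝ≥0 → X → E) (c : ℕ →₀ ℝ) (t : ℝ≥0) :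
    Finsupp.linearCombination ℝ P c t = Finsupp.linearCombination ℝ (fun j => P j t) c := by
  simp [Finsupp.linearCombination_apply, Finsupp.sum, Finset.sum_apply]

lemma isCadlag_linearCombination {P : ℕ → ℝ≥0 → X → E} (hP : ∀ j, IsCadlag (P j))
    (c : ℕ →₀ ℝ) : IsCadlag (Finsupp.linearCombination ℝ P c) := by
  rw [Finsupp.linearCombination_apply]
  exact Finset.sum_induction _ IsCadlag (fun _ _ h h' => h.add h') isCadlag_zero
    fun j _ => (hP j).const_smul _

lemma martingale_linearCombination [CompleteSpace E] {P : ℕ → ℝ≥0 → X → E}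
    (hP : ∀ j, Martingale (P j) F μ) (c : ℕ →₀ ℝ) :
    Martingale (Finsupp.linearCombination ℝ P c) F μ := by
  rw [Finsupp.linearCombination_apply]
  exact Finset.sum_induction _ (fun M => Martingale M F μ) (fun _ _ h h' => h.add h')
    (martingale_zero _ _ _) fun j _ => (hP j).smul _

/-- If the martingales are stopped at times which are summably rarely finite, and the stopped
values are uniformly integrable, then forward convex combinations converge in the u.c.p.
topology. -/
theorem exists_tendstoUcp_of_stopped [CompleteSpace E] [IsProbabilityMeasure μ]
    (hE : IsReflexiveSpace E) (hF : IsStochasticBasis F μ) {P : ℕ → ℝ≥0 → X → E}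
    (hP : ∀ j, MemHardy F μ (P j)) {τ : ℕ → X → WithTop ℝ≥0} (hτ : ∀ j, IsStoppingTime F (τ j))
    (hsum : ∑' j, μ {ω | τ j ω ≠ ⊤} ≠ ∞)
    (hui : ∀ i : ℕ, ∀ ε > 0, ∃ K : ℝ≥0, ∀ j,
      ∫⁻ ω, (‖stopped (P j) (τ j) i ω‖ₑ - K) ∂μ ≤ ε) :
    ∃ N : ℕ → ℝ≥0 → X → E, IsForwardConvex P N ∧ ∃ L, TendstoUcp F μ N L := by
  let Q : ℕ → ℝ≥0 → X → E := fun j => stopped (P j) (τ j)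
  have hQM : ∀ j, Martingale (Q j) F μ := fun j => (hP j).martingale_stopped (hτ j)
  have hQc : ∀ j, IsCadlag (Q j) := fun j => (hP j).cadlag.isCadlag_stopped (τ j)
  obtain ⟨c, hc, hcC⟩ := exists_isForwardCoeff_cauchy hE μ (Z := fun i j => Q j i)
    (fun i j => ((hQM j).1 i).mono (F.le _)) hui
  let N : ℕ → ℝ≥0 → X → E := fun k => Finsupp.linearCombination ℝ P (c k)
  let S : ℕ → ℝ≥0 → X → E := fun k => Finsupp.linearCombination ℝ Q (c k)
  have hPN : IsForwardConvex P N := by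
    intro k
    have hconv := (convex_convexHull ℝ (P '' Set.Ici k)).linear_preimage
      (Finsupp.linearCombination ℝ P)
    refine convexHull_image_Ici_subset hconv (fun j hj => ?_) (hc k)
    rw [Set.mem_preimage, Finsupp.linearCombination_single, one_smul]
    exact subset_convexHull ℝ _ ⟨j, hj, rfl⟩
  have hNc : ∀ k, IsCadlag (N k) := fun k =>
    isCadlag_linearCombination (fun j => (hP j).cadlag) _
  have hNM : ∀ k, Martingale (N k) F μ := fun k =>
    martingale_linearCombination (fun j => (hP j).martingale) _
  have hSc : ∀ k, IsCadlag (S k) := fun k => isCadlag_linearCombination hQc _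
  have hSM : ∀ k, Martingale (S k) F μ := fun k => martingale_linearCombination hQM _
  -- Off `B n` no martingale of index at least `n` is stopped, so forward combinations with and
  -- without stopping coincide there; the measure of `B n` is bounded by the tail of a convergent
  -- series.
  let B : ℕ → Set X := fun n => ⋃ j, {ω | τ (j + n) ω ≠ ⊤}
  have hB : Tendsto (fun n => μ (B n)) atTop (𝓝 0) :=
    tendsto_of_tendsto_of_tendsto_of_le_of_le tendsto_const_nhds
      (ENNReal.tendsto_sum_nat_add _ hsum) (fun n => zero_le) (fun n => measure_iUnion_le _)
  have hNS : ∀ n k, n ≤ k → ∀ ω ∉ B n, ∀ t, N k t ω = S k t ω := by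
    intro n k hk ω hω t
    have hconv : Convex ℝ {v : ℕ →₀ ℝ | Finsupp.linearCombination ℝ P v t ω =
        Finsupp.linearCombination ℝ Q v t ω} := by
      intro u hu v hv a b _ _ _
      simp only [Set.mem_ofPred_eq, map_add, map_smul, Pi.add_apply, Pi.smul_apply] at hu hv ⊢
      rw [hu, hv]
    refine convexHull_image_Ici_subset hconv (fun j hj => ?_) (hc k)
    rw [Set.mem_ofPred_eq, Finsupp.linearCombination_single, Finsupp.linearCombination_single,
      one_smul, one_smul]
    have htop : τ j ω = ⊤ := by
      by_contra hne
      refine hω (Set.mem_iUnion.2 ⟨j - n, ?_⟩)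
      rw [Nat.sub_add_cancel (hk.trans hj)]
      exact hne
    exact (stopped_of_eq_top htop t).symm
  obtain ⟨φ, hφ, L, hL⟩ := exists_subseq_tendstoUcp (N := N) hF (fun k => (hNM k).1) hNc (by
    intro T ε hε
    have hε2 : (0 : ℝ≥0∞) < ε / 2 := ENNReal.div_pos (by simpa using hε.ne') (by simp)
    obtain ⟨n₁, hn₁⟩ := (hB.eventually (gt_mem_nhds hε2)).exists
    -- Doob's inequality divides by `ε`, which turns `ε * (ε / 2)` into the probability bound `ε /
    -- 2`.
    obtain ⟨n₂, hn₂⟩ := hcC T (ε * (ε / 2)) (ENNReal.mul_pos (by simpa using hε.ne') hε2.ne')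
    refine ⟨max n₁ n₂, fun k l hk hl => ?_⟩
    have hsub : {ω | (ε : ℝ≥0∞) < maxUpTo (N k - N l) T ω} ⊆
        B n₁ ∪ {ω | (ε : ℝ≥0∞) < maxUpTo (S k - S l) T ω} := by
      intro ω hω
      by_cases hωB : ω ∈ B n₁
      · exact Or.inl hωB
      · refine Or.inr ?_
        have : maxUpTo (N k - N l) T ω = maxUpTo (S k - S l) T ω := by
          simp only [maxUpTo, Pi.sub_apply, hNS n₁ k ((le_max_left _ _).trans hk) ω hωB,
            hNS n₁ l ((le_max_left _ _).trans hl) ω hωB]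
        rw [Set.mem_ofPred_eq, ← this]
        exact hω
    have hdoob : μ {ω | (ε : ℝ≥0∞) < maxUpTo (S k - S l) T ω} ≤ ε / 2 := by
      have h1 := ((hSc k).sub (hSc l)).mul_measure_lt_maxUpTo_le ((hSM k).sub (hSM l)) T ε
      have h2 := hn₂ k l ((le_max_right _ _).trans hk) ((le_max_right _ _).trans hl)
      rw [← linearCombination_process_apply, ← linearCombination_process_apply] at h2
      exact (ENNReal.mul_le_mul_iff_right (by simpa using hε.ne') ENNReal.coe_ne_top).1
        (h1.trans h2)
    calc μ {ω | (ε : ℝ≥0∞) < maxUpTo (N k - N l) T ω}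
        ≤ μ (B n₁) + μ {ω | (ε : ℝ≥0∞) < maxUpTo (S k - S l) T ω} :=
          (measure_mono hsub).trans (measure_union_le _ _)
      _ ≤ ε / 2 + ε / 2 := add_le_add hn₁.le hdoob
      _ = ε := ENNReal.add_halves _)
  exact ⟨N ∘ φ, hPN.trans (IsForwardConvex.subseq N hφ), L, hL⟩

/-- The uniform integrability of the jumps at stopping times gives, along a subsequence, stopping
times at which the stopped martingales are uniformly integrable. -/
theorem exists_stopped_of_jump [CompleteSpace E] [IsProbabilityMeasure μ]
    (hF : IsStochasticBasis F μ) {M : ℕ → ℝ≥0 → X → E} (hM : ∀ n, MemHardy F μ (M n)) {C : ℝ≥0}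
    (hC : ∀ n, hardyNorm μ (M n) ≤ C)
    (hUI : UniformlyIntegrableAtStoppingTimes F μ fun n => jump (M n)) :
    ∃ φ : ℕ → ℕ, StrictMono φ ∧ ∃ τ : ℕ → X → WithTop ℝ≥0, (∀ j, IsStoppingTime F (τ j)) ∧
      ∑' j, μ {ω | τ j ω ≠ ⊤} ≠ ∞ ∧
      ∀ i : ℕ, ∀ ε > 0, ∃ K : ℝ≥0, ∀ j,
        ∫⁻ ω, (‖stopped (M (φ j)) (τ j) i ω‖ₑ - K) ∂μ ≤ ε := by
  have hmax : ∀ n, Measurable (maxFun (M n)) := fun n =>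
    (hM n).cadlag.measurable_maxFun fun t => ((hM n).martingale.1 t).mono (F.le t)
  obtain ⟨φ, hφ, hφK⟩ := exists_strictMono_lintegral_min_tsub_le μ hmax hC
  have hst : ∀ j, IsStoppingTime F (exitTime (M (φ j)) (2 ^ j)) := fun j =>
    (hM _).cadlag.isStoppingTime_exitTime hF (hM _).martingale.1 _
  refine ⟨φ, hφ, fun j => exitTime (M (φ j)) (2 ^ j), hst, ?_, fun i ε hε => ?_⟩
  · refine ne_top_of_le_ne_top (b := ∑' j : ℕ, (C : ℝ≥0∞) * 2⁻¹ ^ j) ?_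
      (ENNReal.tsum_le_tsum fun j => ?_)
    · rw [ENNReal.tsum_mul_left, ENNReal.tsum_geometric]
      exact ENNReal.mul_ne_top ENNReal.coe_ne_top (by simp)
    · have h1 : μ {ω | exitTime (M (φ j)) (2 ^ j) ω ≠ ⊤} ≤
          μ {ω | (2 : ℝ≥0∞) ^ j ≤ maxFun (M (φ j)) ω} :=
        measure_mono fun ω hω => by
          have := (lt_maxFun_of_exitTime_ne_top hω).le
          push_cast at this
          exact this
      have h2 := (mul_meas_ge_le_lintegral (μ := μ) (hmax (φ j)) ((2 : ℝ≥0∞) ^ j)).trans (hC (φ j))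
      refine h1.trans ?_
      rw [← ENNReal.inv_pow, ← div_eq_mul_inv, ENNReal.le_div_iff_mul_le (by simp) (by simp),
        mul_comm]
      exact h2
  · have hε2 : (0 : ℝ≥0∞) < ε / 2 := ENNReal.div_pos hε.ne' (by simp)
    obtain ⟨K₁, hK₁⟩ := hφK (ε / 2) hε2
    obtain ⟨K₂, hK₂⟩ := UniformIntegrable.exists_lintegral_tsub_le hUI hε2
    -- One level for each part of the bound: the truncated maximal function, the initial value,
    -- which has no excess over `C`, and the jump at the exit time.
    refine ⟨K₁ + C + K₂, fun j => ?_⟩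
    have h0 : ∀ᵐ ω ∂μ, ‖stopped (M (φ j)) (exitTime (M (φ j)) (2 ^ j)) i ω‖ₑ -
        ((K₁ + C + K₂ : ℝ≥0) : ℝ≥0∞) ≤
        (min (maxFun (M (φ j)) ω) ((2 ^ j : ℝ≥0) : ℝ≥0∞) - K₁) +
          (‖valueAt (jump (M (φ j))) (exitTime (M (φ j)) (2 ^ j)) ω‖ₑ - K₂) := by
      filter_upwards [(hM (φ j)).enorm_zero_le hF (hC (φ j))] with ω hω
      rw [ENNReal.coe_add, ENNReal.coe_add]
      refine (tsub_le_tsub_right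
        ((hM (φ j)).cadlag.enorm_stopped_exitTime_le (2 ^ j) i ω) _).trans ?_
      refine add_tsub_add_le_tsub_add_tsub.trans (add_le_add_left ?_ _)
      refine add_tsub_add_le_tsub_add_tsub.trans ?_
      rw [tsub_eq_zero_of_le hω, add_zero]
    refine (lintegral_mono_ae h0).trans ?_
    rw [lintegral_add_left (((hmax _).min measurable_const).sub_const _)]
    refine (add_le_add (hK₁ j) (hK₂ (φ j, ⟨_, hst j⟩))).trans (ENNReal.add_halves ε).le

end Combination

end HardyMartingale
end

/-! ### The two uniform integrability conditions -/

theorem proposition4p2 {X E : Type*} {m : MeasurableSpace X} (μ : Measure X)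
    [IsProbabilityMeasure μ] (F : Filtration ℝ≥0 m)
    (hF : HardyMartingale.IsStochasticBasis F μ)
    [NormedAddCommGroup E] [NormedSpace ℝ E] [CompleteSpace E]
    (hE : HardyMartingale.IsReflexiveSpace E)
    (M : ℕ → ℝ≥0 → X → E)
    (hM : ∀ n, HardyMartingale.MemHardy F μ (M n))
    (hbdd : ∃ C : ℝ≥0, ∀ n, HardyMartingale.hardyNorm μ (M n) ≤ C)
    (hUI : HardyMartingale.UniformlyIntegrableAtStoppingTimes F μ M ∨
      HardyMartingale.UniformlyIntegrableAtStoppingTimes F μ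
        (fun n => HardyMartingale.jump (M n))) :
    ∃ (N : ℕ → ℝ≥0 → X → E) (L : ℝ≥0 → X → E),
      (∀ k, N k ∈ convexHull ℝ {P | ∃ n, k ≤ n ∧ P = M n}) ∧
      HardyMartingale.TendstoUcp F μ N L := by
  obtain ⟨C, hC⟩ := hbdd
  obtain ⟨φ, hφ, τ, hτ, hsum, hui⟩ : ∃ φ : ℕ → ℕ, StrictMono φ ∧ ∃ τ : ℕ → X → WithTop ℝ≥0,
      (∀ j, IsStoppingTime F (τ j)) ∧ ∑' j, μ {ω | τ j ω ≠ ⊤} ≠ ∞ ∧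
      ∀ i : ℕ, ∀ ε > 0, ∃ K : ℝ≥0, ∀ j,
        ∫⁻ ω, (‖HardyMartingale.stopped (M (φ j)) (τ j) i ω‖ₑ - K) ∂μ ≤ ε := by
    rcases hUI with hUI | hUI
    -- Nothing is stopped here, and uniform integrability at the constant stopping times `i` is
    -- enough.
    · refine ⟨id, strictMono_id, fun _ _ => ⊤, fun _ i => ?_, by simp,
        fun i ε hε => ?_⟩
      · exact MeasurableSet.congr (@MeasurableSet.empty X (F i)) (Set.eq_empty_of_forall_notMem
          fun ω (h : (⊤ : WithTop ℝ≥0) ≤ i) => WithTop.coe_ne_top (top_le_iff.1 h)).symm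
      obtain ⟨K, hK⟩ := HardyMartingale.UniformIntegrable.exists_lintegral_tsub_le hUI hε
      refine ⟨K, fun j => ?_⟩
      have h := hK (j, ⟨fun _ => ((i : ℝ≥0) : WithTop ℝ≥0), isStoppingTime_const F (i : ℝ≥0)⟩)
      simp only [HardyMartingale.stopped_of_eq_top, id]
      exact h
    · exact HardyMartingale.exists_stopped_of_jump hF hM hC hUI
  obtain ⟨N, hN, L, hL⟩ := HardyMartingale.exists_tendstoUcp_of_stopped hE hF
    (fun j => hM (φ j)) hτ hsum hui
  refine ⟨N, L, fun k => convexHull_mono ?_ (hN k), hL⟩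
  rintro _ ⟨j, hj, rfl⟩
  exact ⟨φ j, (Set.mem_Ici.1 hj).trans hφ.le_apply, rfl⟩
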